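/- Let $D=\{z\in\mathbb{C}:|z|<4\}\setminus\{-2,0,2\}$ be the thrice-punctured open disk. For $c\in\{-1,1\}$ let $h_c$ be the half twist about $c$, the compactly supported homeomorphism of $D$ given by $$h_c(z)=c+e^{i\pi\theta(|z-c|)}(z-c),\qquad \theta(r)=\max\bigl(0,\min(1,\tfrac52-r)\bigr),$$ and put $\sigma_1=h_{-1}$ (which exchanges the punctures $-2$ and $0$) and $\sigma_2=h_{1}$ (which exchanges the punctures $0$ and $2$). Under the identification of the braid group $B_3$ with the group of compactly supported mapping classes of $D$, these homeomorphisms represent the standard generators of $B_3$. Let $\beta=\sigma_1\sigma_2^{-1}$ (composition of homeomorphisms), and let $M_\beta=(D\times\mathbb{R})/\bigl((x,s+1)\sim(\beta(x),s)\bigr)$ be its mapping torus (the suspension of $\beta$). For a prime $p$, a group $G$ is called residually $p$ if for every $g\in G$ with $g\neq 1$ there is a normal subgroup $N$ of $G$ whose index is a finite power of $p$ and such that $g\notin N$. Then for every base point $x\in M_\beta$ and every prime $p$, the group $\pi_1(M_\beta,x)$ is residually $p$ if and only if $p=3$. -/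

import Mathlib

/-- A group `G` is residually `p` if every nontrivial element survives in a finite quotient of
`G` whose order is a power of `p`. -/
def IsResiduallyP (p : ℕ) (G : Type*) [Group G] : Prop :=
  ∀ g : G, g ≠ 1 → ∃ N : Subgroup G, N.Normal ∧ (∃ k : ℕ, N.index = p ^ k) ∧ g ∉ N

/-- The equivalence relation on `X × ℝ` generated by `(x, s + 1) ∼ (ψ x, s)`: the orbit relation
of the `ℤ`-action in which `n` sends `(x, s)` to `(ψ ^ n x, s - n)`. -/
def mappingTorusSetoid {X : Type*} [TopologicalSpace X] (ψ : X ≃ₜ X) : Setoid (X × ℝ) where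
  r a b := ∃ n : ℤ, b = ((ψ ^ n) a.1, a.2 - n)
  iseqv :=
    { refl := fun a => ⟨0, by simp⟩
      symm := by
        rintro ⟨x, s⟩ _ ⟨n, rfl⟩
        refine ⟨-n, ?_⟩
        have h : (ψ ^ (-n)) ((ψ ^ n) x) = x := by
          rw [← Homeomorph.mul_apply, ← zpow_add]; simp
        simp only [h]
        push_cast
        simp
      trans := by
        rintro ⟨x, s⟩ _ _ ⟨n, rfl⟩ ⟨m, rfl⟩
        refine ⟨m + n, ?_⟩
        simp only [zpow_add, Homeomorph.mul_apply]
        push_cast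
        ring_nf }

/-- The mapping torus (suspension) of a homeomorphism `ψ : X ≃ₜ X`, the quotient of `X × ℝ` by
`(x, s + 1) ∼ (ψ x, s)`; equivalently `X × [0, 1]` with `(x, 1)` glued to `(ψ x, 0)`. -/
def MappingTorus {X : Type*} [TopologicalSpace X] (ψ : X ≃ₜ X) : Type _ :=
  Quotient (mappingTorusSetoid ψ)

instance {X : Type*} [TopologicalSpace X] (ψ : X ≃ₜ X) : TopologicalSpace (MappingTorus ψ) :=
  inferInstanceAs (TopologicalSpace (Quotient (mappingTorusSetoid ψ)))

/-- The cut-off function of a half twist: `1` for `r ≤ 3/2`, `0` for `r ≥ 5/2`, linear between. -/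
noncomputable def twistProfile (r : ℝ) : ℝ := max 0 (min 1 (5 / 2 - r))

/-- The map rotating the circle of radius `r` about `c` by the angle `a * twistProfile r`. -/
noncomputable def twistMap (c : ℂ) (a : ℝ) (z : ℂ) : ℂ :=
  c + Complex.exp (((a * twistProfile ‖z - c‖ : ℝ) : ℂ) * Complex.I) * (z - c)

theorem norm_twistMap_sub (c : ℂ) (a : ℝ) (z : ℂ) : ‖twistMap c a z - c‖ = ‖z - c‖ := by
  unfold twistMap
  rw [add_sub_cancel_left, norm_mul, Complex.norm_exp_ofReal_mul_I, one_mul]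

theorem twistMap_neg_twistMap (c : ℂ) (a : ℝ) (z : ℂ) :
    twistMap c (-a) (twistMap c a z) = z := by
  have h := norm_twistMap_sub c a z
  have h2 : twistMap c a z - c =
      Complex.exp (((a * twistProfile ‖z - c‖ : ℝ) : ℂ) * Complex.I) * (z - c) := by
    unfold twistMap; ring
  rw [twistMap, h, h2, ← mul_assoc, ← Complex.exp_add]
  have h3 : (((-a * twistProfile ‖z - c‖ : ℝ) : ℂ) * Complex.I) +
      (((a * twistProfile ‖z - c‖ : ℝ) : ℂ) * Complex.I) = 0 := by
    push_cast; ring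
  rw [h3, Complex.exp_zero]
  ring

theorem continuous_twistMap (c : ℂ) (a : ℝ) : Continuous (twistMap c a) := by
  unfold twistMap twistProfile
  fun_prop

/-- The half twist of the plane about `c`: the counterclockwise rotation by `π` about `c` on the
disk of radius `3/2`, and the identity outside the disk of radius `5/2`. -/
noncomputable def planeHalfTwist (c : ℂ) : ℂ ≃ₜ ℂ where
  toFun := twistMap c Real.pi
  invFun := twistMap c (-Real.pi)
  left_inv := twistMap_neg_twistMap c Real.pi
  right_inv z := by
    have h := twistMap_neg_twistMap c (-Real.pi) z
    rwa [neg_neg] at h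
  continuous_toFun := continuous_twistMap c _
  continuous_invFun := continuous_twistMap c _

/-- The open disk of radius `4` about `0` with the punctures `-2`, `0`, `2` removed. -/
def puncturedDisk : Set ℂ := Metric.ball 0 4 \ {-2, 0, 2}

theorem twistMap_of_le {c : ℂ} {a : ℝ} {z : ℂ} (h : 5 / 2 ≤ ‖z - c‖) : twistMap c a z = z := by
  have h1 : twistProfile ‖z - c‖ = 0 := by
    unfold twistProfile
    exact max_eq_left ((min_le_right _ _).trans (by linarith))
  simp [twistMap, h1]

theorem twistMap_pi_of_le {c z : ℂ} {a : ℝ} (ha : a = Real.pi ∨ a = -Real.pi)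
    (h : ‖z - c‖ ≤ 3 / 2) : twistMap c a z = 2 * c - z := by
  have h1 : twistProfile ‖z - c‖ = 1 := by
    unfold twistProfile
    rw [min_eq_left (by linarith)]
    exact max_eq_right zero_le_one
  have h2 : Complex.exp (((a * 1 : ℝ) : ℂ) * Complex.I) = -1 := by
    rcases ha with rfl | rfl
    · simp [Complex.exp_pi_mul_I]
    · simp [Complex.exp_neg, Complex.exp_pi_mul_I]
  rw [twistMap, h1, h2]
  ring

theorem twistMap_mem_punctures {c : ℂ} (hc : c = -1 ∨ c = 1) {a : ℝ}
    (ha : a = Real.pi ∨ a = -Real.pi) {z : ℂ} (hz : z ∈ ({-2, 0, 2} : Set ℂ)) :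
    twistMap c a z ∈ ({-2, 0, 2} : Set ℂ) := by
  rcases hc with rfl | rfl <;> rcases hz with rfl | rfl | rfl
  · rw [twistMap_pi_of_le ha (by norm_num)]; norm_num
  · rw [twistMap_pi_of_le ha (by norm_num)]; norm_num
  · rw [twistMap_of_le (by norm_num)]; norm_num
  · rw [twistMap_of_le (by norm_num)]; norm_num
  · rw [twistMap_pi_of_le ha (by norm_num)]; norm_num
  · rw [twistMap_pi_of_le ha (by norm_num)]; norm_num

theorem twistMap_mem_ball {c : ℂ} (hc : c = -1 ∨ c = 1) {a : ℝ} {z : ℂ}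
    (hz : z ∈ Metric.ball (0 : ℂ) 4) : twistMap c a z ∈ Metric.ball (0 : ℂ) 4 := by
  by_cases h : 5 / 2 ≤ ‖z - c‖
  · rwa [twistMap_of_le h]
  · have hc1 : ‖c‖ = 1 := by rcases hc with rfl | rfl <;> simp
    have h1 := norm_twistMap_sub c a z
    have h2 : ‖twistMap c a z‖ ≤ ‖twistMap c a z - c‖ + ‖c‖ := by
      simpa using norm_add_le (twistMap c a z - c) c
    rw [mem_ball_zero_iff]
    push Not at h
    linarith

theorem twistMap_mem_puncturedDisk {c : ℂ} (hc : c = -1 ∨ c = 1) {a : ℝ}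
    (ha : a = Real.pi ∨ a = -Real.pi) {z : ℂ} (hz : z ∈ puncturedDisk) :
    twistMap c a z ∈ puncturedDisk := by
  refine ⟨twistMap_mem_ball hc hz.1, fun h => hz.2 ?_⟩
  have ha2 : -a = Real.pi ∨ -a = -Real.pi := by
    rcases ha with rfl | rfl
    · exact Or.inr rfl
    · exact Or.inl (neg_neg _)
  have := twistMap_mem_punctures hc ha2 h
  rwa [twistMap_neg_twistMap] at this

theorem planeHalfTwist_mem_iff {c : ℂ} (hc : c = -1 ∨ c = 1) (z : ℂ) :
    z ∈ puncturedDisk ↔ planeHalfTwist c z ∈ puncturedDisk := by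
  refine ⟨fun h => twistMap_mem_puncturedDisk hc (Or.inl rfl) h, fun h => ?_⟩
  have h2 := twistMap_mem_puncturedDisk hc (a := -Real.pi) (Or.inr rfl) h
  have h3 : twistMap c (-Real.pi) (planeHalfTwist c z) = z := twistMap_neg_twistMap c Real.pi z
  rwa [h3] at h2

/-- The standard braid generator `σ₁` as a compactly supported homeomorphism of the thrice-punctured
disk: the half twist exchanging the punctures `-2` and `0`. -/
noncomputable def sigma1 : puncturedDisk ≃ₜ puncturedDisk :=
  (planeHalfTwist (-1)).subtype (planeHalfTwist_mem_iff (Or.inl rfl))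

/-- The standard braid generator `σ₂` as a compactly supported homeomorphism of the thrice-punctured
disk: the half twist exchanging the punctures `0` and `2`. -/
noncomputable def sigma2 : puncturedDisk ≃ₜ puncturedDisk :=
  (planeHalfTwist 1).subtype (planeHalfTwist_mem_iff (Or.inr rfl))

/-- The braid `β = σ₁ σ₂⁻¹` (product in the group of self-homeomorphisms, i.e. composition). -/
noncomputable def braidBeta : puncturedDisk ≃ₜ puncturedDisk := sigma1 * sigma2⁻¹

theorem one_mem_puncturedDisk : (1 : ℂ) ∈ puncturedDisk := by
  constructor
  · simp
  · norm_num

instance : Nonempty (MappingTorus braidBeta) :=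
  ⟨Quotient.mk (mappingTorusSetoid braidBeta) (⟨1, one_mem_puncturedDisk⟩, 0)⟩

/-! The group is an extension F₃ ⋊ ℤ, where F₃ is the fundamental group of the punctured disk and ℤ
acts by the automorphism α that β induces. The braid moves the punctures in the 3-cycle −2 → 0 → 2 →
−2, so α permutes the standard basis of the abelianization of F₃ cyclically. This is all that is
needed about α.

Suppose p ≠ 3. In a finite p-quotient, t^(p^m) dies for some m, where t is the generator of ℤ, so
α^(p^m) becomes invisible on the image of F₃. A maximal subgroup of that image has abelian quotient,
in which the basis elements are invariant under a nontrivial rotation of the indices and hence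
coincide. If it contained one of them it would contain all, so one basis element already generates
the image, and every commutator in F₃ dies (`commute_of_isPGroup`).

Suppose p = 3. Congruence quotients of a free subgroup of SL(2, ℤ) show that F₃ is residually 3
(`exists_three_group_quotient`). Each finite 3-quotient is dominated by an α-stable one, Q. Since α³
is trivial on the abelianization, Burnside's theorem on automorphisms trivial modulo the Frattini
subgroup (`IsPGroup.exists_mulAut_pow_eq_one`) makes the order of α on Q a power of 3, so Q extends
to a finite 3-quotient of F₃ ⋊ ℤ. Elements outside F₃ survive in a cyclic quotient of ℤ.

Topologically, the disk is a union of two star-shaped slit disks meeting in four gaps. Subdividing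
paths shows that three crossing loops generate; the monodromy of a bundle with fibre F₃ shows that
they are free (`exists_freeGroup_mulEquiv`). Winding numbers detect the abelianization, and rotating
the plane gradually shows how half twists permute them (`punctureWinding_braidBeta`). The ℤ-covering
of the mapping torus by a cylinder yields the semidirect product (`exists_freeByCyclic_mulEquiv`).
-/

/-! ### Free groups of rank three are residually `3` -/

open Matrix in
/-- Three parabolic matrices congruent to `1` modulo `6`, fixing the slopes `∞`, `0` and `1`. -/
def parabolicTriple : Fin 3 → SpecialLinearGroup (Fin 2) ℤ :=
  ![⟨!![1, 6; 0, 1], by simp [det_fin_two]⟩, ⟨!![1, 0; 6, 1], by simp [det_fin_two]⟩,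
    ⟨!![7, -6; 6, -5], by simp [det_fin_two]⟩]

/-- The first column of a matrix in coordinates adapted to the parabolic matrix of index `i`. -/
def adaptedColumn (i : Fin 3) (g : Matrix.SpecialLinearGroup (Fin 2) ℤ) : ℤ × ℤ :=
  ![(g.1 0 0, g.1 1 0), (g.1 1 0, g.1 0 0), (g.1 1 0, g.1 0 0 - g.1 1 0)] i

theorem adaptedColumn_mul (i : Fin 3) (g : Matrix.SpecialLinearGroup (Fin 2) ℤ) :
    adaptedColumn i (parabolicTriple i * g) =
      ((adaptedColumn i g).1 + 6 * (adaptedColumn i g).2, (adaptedColumn i g).2) := by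
  have h : ∀ j, (parabolicTriple i * g).1 j 0 =
      (parabolicTriple i).1 j 0 * g.1 0 0 + (parabolicTriple i).1 j 1 * g.1 1 0 := by
    intro j
    simp [Matrix.mul_apply, Fin.sum_univ_two]
  simp only [adaptedColumn, h]
  fin_cases i <;> simp [parabolicTriple] <;> ring_nf <;> simp

theorem firstColumn_ne_zero (g : Matrix.SpecialLinearGroup (Fin 2) ℤ) :
    0 < g.1 0 0 ^ 2 + g.1 1 0 ^ 2 := by
  have h := g.2
  rw [Matrix.det_fin_two] at h
  by_contra hc
  have h0 : g.1 0 0 = 0 := by nlinarith [sq_nonneg (g.1 0 0), sq_nonneg (g.1 1 0)]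
  have h1 : g.1 1 0 = 0 := by nlinarith [sq_nonneg (g.1 0 0), sq_nonneg (g.1 1 0)]
  simp [h0, h1] at h

/-- The hypotheses say |u| ≥ 3|v| (or v = 0) in adapted coordinates, so the slope of the first
column is close to the fixed slope of each of two parabolics. The neighbourhoods of ∞, 0 and 1 so
described do not overlap. -/
theorem disjoint_pingPong (i j : Fin 3) (hij : i ≠ j) (g : Matrix.SpecialLinearGroup (Fin 2) ℤ)
    (hi : 3 * (adaptedColumn i g).2 ^ 2 ≤ |(adaptedColumn i g).1 * (adaptedColumn i g).2|)
    (hj : 3 * (adaptedColumn j g).2 ^ 2 ≤ |(adaptedColumn j g).1 * (adaptedColumn j g).2|) :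
    False := by
  have hg := firstColumn_ne_zero g
  set x := g.1 0 0
  set y := g.1 1 0
  fin_cases i <;> fin_cases j <;> simp [adaptedColumn, -abs_mul] at hi hj hij <;>
    rcases le_abs.1 hi with hi | hi <;> rcases le_abs.1 hj with hj | hj <;>
    nlinarith [sq_nonneg (x - y), sq_nonneg (x + y), sq_nonneg x, sq_nonneg y,
      sq_nonneg (x - 2 * y), sq_nonneg (2 * x - y)]

/-- Ping-pong for left multiplication of SL(2, ℤ) on itself, read on first columns. In coordinates
adapted to i, the generator sends u/v to u/v + 6, so it carries u/v ≥ −3 into u/v ≥ 3, and its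
inverse carries u/v < 3 into u/v < −3. -/
theorem injective_lift_parabolicTriple : Function.Injective (FreeGroup.lift parabolicTriple) := by
  let q : Fin 3 → Matrix.SpecialLinearGroup (Fin 2) ℤ → ℤ :=
    fun i g => (adaptedColumn i g).1 * (adaptedColumn i g).2
  let r : Fin 3 → Matrix.SpecialLinearGroup (Fin 2) ℤ → ℤ := fun i g => (adaptedColumn i g).2 ^ 2
  have hr : ∀ i g, 0 ≤ r i g := fun i g => sq_nonneg _
  have hne : ∀ i g, 3 * r i g ≤ |q i g| → ∀ j, i ≠ j → ¬ 3 * r j g ≤ |q j g| :=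
    fun i g hi j hij hj => disjoint_pingPong i j hij g hi hj
  have hX : ∀ i g, 3 * r i g ≤ q i g → 3 * r i g ≤ |q i g| := fun i g h => h.trans (le_abs_self _)
  have hY : ∀ i g, q i g < -3 * r i g → 3 * r i g ≤ |q i g| := fun i g h =>
    le_trans (by linarith) (neg_le_abs _)
  refine FreeGroup.injective_lift_of_ping_pong parabolicTriple
    (fun i => {g | 3 * r i g ≤ q i g}) (fun i => {g | q i g < -3 * r i g}) ?_ ?_ ?_ ?_ ?_ ?_
  · intro i
    -- Matrices whose first column is the fixed direction v = 0 of the generator; the weak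
    -- inequality puts that direction in the attracting set.
    refine ⟨![1, ⟨!![0, -1; 1, 0], by simp [Matrix.det_fin_two]⟩,
      ⟨!![1, 0; 1, 1], by simp [Matrix.det_fin_two]⟩] i, ?_⟩
    fin_cases i <;> simp only [q, r, adaptedColumn, Set.mem_ofPred_eq] <;> simp
  · intro i j hij
    exact Set.disjoint_left.2 fun g hi hj => hne i g (hX i g hi) j hij (hX j g hj)
  · intro i j hij
    exact Set.disjoint_left.2 fun g hi hj => hne i g (hY i g hi) j hij (hY j g hj)
  · intro i j
    refine Set.disjoint_left.2 fun g hi hj => ?_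
    by_cases hij : i = j
    · subst hij
      have := hr i g
      simp only [Set.mem_ofPred_eq] at hi hj
      linarith
    · exact hne i g (hX i g hi) j hij (hY j g hj)
  · rintro i _ ⟨g, hg, rfl⟩
    simp only [Set.mem_compl_iff, Set.mem_ofPred_eq, not_lt, smul_eq_mul, q, r,
      adaptedColumn_mul] at hg ⊢
    linarith
  · rintro i _ ⟨g, hg, rfl⟩
    have h := adaptedColumn_mul i ((parabolicTriple i)⁻¹ * g)
    rw [mul_inv_cancel_left] at h
    simp only [Set.mem_compl_iff, Set.mem_ofPred_eq, not_le, smul_eq_mul, q, r, h,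
      Pi.inv_apply] at hg ⊢
    linarith

theorem exists_one_add_mul_pow_three_pow {R : Type*} [Ring R] (N : R) (j : ℕ) :
    ∃ N' : R, (1 + 3 * N) ^ 3 ^ j = 1 + 3 ^ (j + 1) * N' := by
  induction j with
  | zero => exact ⟨N, by simp⟩
  | succ j ih =>
    obtain ⟨N', h⟩ := ih
    have hc : Commute (3 ^ (j + 1) : R) N' := by
      have := Nat.cast_commute (3 ^ (j + 1)) N'
      simpa using this
    -- Obtained by cubing 1 + 3^(j+1) N' and dividing the nonconstant terms by 3^(j+2).
    refine ⟨N' + 3 ^ (j + 1) * N' ^ 2 + 3 ^ j * 3 ^ j * 3 * N' ^ 3, ?_⟩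
    rw [pow_succ, pow_mul, h, (Commute.one_left _).add_pow]
    simp only [Finset.sum_range_succ, hc.mul_pow]
    simp [Nat.choose]
    noncomm_ring

/-- Reduction modulo `n` of `SL(2, ℤ)`. -/
def reduceSL (n : ℕ) :
    Matrix.SpecialLinearGroup (Fin 2) ℤ →* Matrix.SpecialLinearGroup (Fin 2) (ZMod n) :=
  Matrix.SpecialLinearGroup.map (Int.castRingHom (ZMod n))

theorem reduceSL_three_lift (f : FreeGroup (Fin 3)) :
    reduceSL 3 (FreeGroup.lift parabolicTriple f) = 1 := by
  have : (reduceSL 3).comp (FreeGroup.lift parabolicTriple) = 1 := by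
    ext i a b
    fin_cases i <;> fin_cases a <;> fin_cases b <;>
      simp [reduceSL, parabolicTriple] <;> decide
  exact DFunLike.congr_fun this f

/-- The image of f in SL(2, ℤ) differs from 1 in some entry, hence also modulo a large power of 3.
The quotient is the image of the free group modulo 3^k; it is a 3-group because all its elements are
congruent to 1 modulo 3, so their 3^k-th powers are 1. -/
theorem exists_three_group_quotient {f : FreeGroup (Fin 3)} (hf : f ≠ 1) :
    ∃ (P : Type) (_ : Group P) (_ : Finite P) (ρ : FreeGroup (Fin 3) →* P),
      IsPGroup 3 P ∧ ρ f ≠ 1 := by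
  set L := FreeGroup.lift parabolicTriple with hL
  have h1 : L f ≠ 1 := fun h => hf (injective_lift_parabolicTriple (by rw [← hL, h, map_one]))
  obtain ⟨k, hk⟩ : ∃ k : ℕ, reduceSL (3 ^ k) (L f) ≠ 1 := by
    by_contra! hc
    apply h1
    ext a b
    have hz : ∀ k : ℕ, ((3 : ℤ) ^ k) ∣ (L f).1 a b - (1 : Matrix (Fin 2) (Fin 2) ℤ) a b := by
      intro k
      have := congr_fun₂ (congr_arg Subtype.val (hc k)) a b
      have h2 := (ZMod.intCast_zmod_eq_zero_iff_dvd
        ((L f).1 a b - (1 : Matrix (Fin 2) (Fin 2) ℤ) a b) (3 ^ k)).1 (by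
          simp only [reduceSL, Matrix.SpecialLinearGroup.map_apply_coe] at this
          push_cast
          rw [sub_eq_zero]
          simp only [RingHom.mapMatrix_apply, Matrix.map_apply, eq_intCast] at this
          rw [this]
          by_cases hab : a = b <;> simp [hab, Matrix.one_apply])
      exact_mod_cast h2
    by_contra hne
    have hd : (L f).1 a b - (1 : Matrix (Fin 2) (Fin 2) ℤ) a b ≠ 0 := sub_ne_zero.2 hne
    have hfin : FiniteMultiplicity (3 : ℤ) ((L f).1 a b - (1 : Matrix (Fin 2) (Fin 2) ℤ) a b) :=
      Int.finiteMultiplicity_iff.2 ⟨by decide, hd⟩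
    exact hfin.not_pow_dvd_of_multiplicity_lt (Nat.lt_succ_self _) (hz _)
  have : NeZero (3 ^ k) := ⟨by positivity⟩
  have : Finite (Matrix.SpecialLinearGroup (Fin 2) (ZMod (3 ^ k))) := Subtype.finite
  refine ⟨((reduceSL (3 ^ k)).comp L).range, inferInstance, inferInstance,
    ((reduceSL (3 ^ k)).comp L).rangeRestrict, ?_, fun h => hk (congr_arg Subtype.val h)⟩
  rintro ⟨_, g, rfl⟩
  refine ⟨k, Subtype.ext (Subtype.ext ?_)⟩
  have hdiv : ∀ a b, (3 : ℤ) ∣ (L g).1 a b - (1 : Matrix (Fin 2) (Fin 2) ℤ) a b := by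
    intro a b
    have := congr_fun₂ (congr_arg Subtype.val (reduceSL_three_lift g)) a b
    refine (ZMod.intCast_zmod_eq_zero_iff_dvd _ 3).1 ?_
    simp only [reduceSL, Matrix.SpecialLinearGroup.map_apply_coe, RingHom.mapMatrix_apply,
      Matrix.map_apply, eq_intCast] at this
    push_cast
    rw [sub_eq_zero, this]
    by_cases hab : a = b <;> simp [hab, Matrix.one_apply]
  choose N hN using hdiv
  have hM : (L g).1 = 1 + 3 * Matrix.of N := by
    ext a b
    have h3 : (3 : Matrix (Fin 2) (Fin 2) ℤ) * Matrix.of N = (3 : ℤ) • Matrix.of N := by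
      rw [zsmul_eq_mul, Int.cast_ofNat]
    rw [h3]
    simp [← hN]
  obtain ⟨N', hN'⟩ := exists_one_add_mul_pow_three_pow (Matrix.of N) k
  have hp : ((L g) ^ 3 ^ k).1 = 1 + 3 ^ (k + 1) * N' := by
    rw [Matrix.SpecialLinearGroup.coe_pow, hM, hN']
  have h0 : (3 : Matrix (Fin 2) (Fin 2) (ZMod (3 ^ k))) ^ (k + 1) = 0 := by
    have : ((3 ^ k : ℕ) : Matrix (Fin 2) (Fin 2) (ZMod (3 ^ k))) = 0 := by
      rw [← Matrix.diagonal_natCast, ZMod.natCast_self, Matrix.diagonal_zero]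
    rw [pow_succ]
    push_cast at this
    rw [this, zero_mul]
  have h2 : (reduceSL (3 ^ k) ((L g) ^ 3 ^ k)).1 = 1 := by
    simp only [reduceSL, Matrix.SpecialLinearGroup.map_apply_coe]
    rw [hp, map_add, map_one, map_mul, map_pow, map_ofNat, h0, zero_mul, add_zero]
  simpa using h2

/-! ### Finite `p`-groups and residual properties of `F₃ ⋊ ℤ` -/

/-- Maximal subgroups of a nilpotent group are normal. The quotient is solvable and nontrivial, so
its commutator subgroup is proper, and maximality forces that subgroup to be trivial. -/
theorem IsPGroup.exists_commGroup_hom_ker_eq {p : ℕ} [Fact p.Prime] {P : Type} [Group P] [Finite P]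
    (hP : IsPGroup p P) {M : Subgroup P} (hM : IsCoatom M) :
    ∃ (T : Type) (_ : CommGroup T) (q : P →* T), q.ker = M := by
  have hnil : Group.IsNilpotent P := hP.isNilpotent
  have hn : M.Normal := ((Group.isNilpotent_of_finite_tfae (G := P)).out 0 2 rfl rfl).1 hnil M hM
  have hnt : Nontrivial (P ⧸ M) := QuotientGroup.nontrivial_iff.2 hM.1
  have hsol : Group.IsSolvable (P ⧸ M) := inferInstance
  have hlt := hsol.commutator_lt_top_of_nontrivial
  have hle : M ≤ (commutator (P ⧸ M)).comap (QuotientGroup.mk' M) := by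
    intro x hx
    rw [Subgroup.mem_comap, QuotientGroup.mk'_apply, (QuotientGroup.eq_one_iff x).2 hx]
    exact one_mem _
  have hcomm : commutator P ≤ M := by
    have h1 : (commutator (P ⧸ M)).comap (QuotientGroup.mk' M) = M := by
      rcases hle.eq_or_lt with h | h
      · exact h.symm
      · have htop := hM.2 _ h
        refine absurd (Subgroup.comap_injective (QuotientGroup.mk'_surjective M) ?_) hlt.ne
        rw [htop, Subgroup.comap_top]
    rw [← h1, ← Subgroup.map_le_iff_le_comap]
    rw [commutator_def, Subgroup.map_commutator, commutator_def]
    exact Subgroup.commutator_mono le_top le_top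
  let _ : CommGroup (P ⧸ M) :=
    { (inferInstance : Group (P ⧸ M)) with
      mul_comm := (Subgroup.Normal.quotient_commutative_iff_commutator_le.2 hcomm).is_comm.comm }
  exact ⟨P ⧸ M, inferInstance, QuotientGroup.mk' M, QuotientGroup.ker_mk' M⟩

/-- An automorphism of a finite `p`-group acting trivially modulo every maximal subgroup has order
a power of `p`. -/
theorem IsPGroup.exists_mulAut_pow_eq_one {p : ℕ} [Fact p.Prime] {Q : Type*} [Group Q] [Finite Q]
    (hQ : IsPGroup p Q) (A : MulAut Q)
    (hA : ∀ M : Subgroup Q, IsCoatom M → ∀ x, x⁻¹ * A x ∈ M) : ∃ m : ℕ, A ^ p ^ m = 1 := by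
  have hfin : Finite (MulAut Q) := Finite.of_injective (fun a : MulAut Q => (a : Q → Q))
    DFunLike.coe_injective
  have hΦ : ∀ x, x⁻¹ * A x ∈ frattini Q := by
    intro x
    simp only [frattini, Order.radical, Subgroup.mem_iInf]
    exact fun M hM => hA M hM x
  have hpow : ∀ k x, x⁻¹ * (A ^ k) x ∈ frattini Q := by
    intro k
    induction k with
    | zero => simp
    | succ k ih =>
      intro x
      have := mul_mem (ih x) (hΦ ((A ^ k) x))
      rwa [mul_assoc, mul_inv_cancel_left, ← MulAut.mul_apply, ← pow_succ'] at this
  have hn : orderOf A ≠ 0 := (orderOf_pos A).ne'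
  refine ⟨(orderOf A).primeFactorsList.length, ?_⟩
  rw [← Nat.eq_prime_pow_of_unique_prime_dvd (p := p) hn, pow_orderOf_eq_one]
  intro q hq hqn
  by_contra hqp
  have : Fact q.Prime := ⟨hq⟩
  -- If a prime q ≠ p divided the order, γ would have order q while preserving every coset of the
  -- Frattini subgroup.
  set γ := A ^ (orderOf A / q) with hγ
  have hγq : γ ^ q = 1 := by
    rw [hγ, ← pow_mul, Nat.div_mul_cancel hqn, pow_orderOf_eq_one]
  have hfix : MonoidHom.eqLocus γ.toMonoidHom (MonoidHom.id Q) ⊔ frattini Q = ⊤ := by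
    rw [eq_top_iff]
    intro x _
    classical
    have : Fintype {y : Q // x⁻¹ * y ∈ frattini Q} := Fintype.ofFinite _
    let e : {y : Q // x⁻¹ * y ∈ frattini Q} ≃ frattini Q :=
      { toFun := fun y => ⟨x⁻¹ * y.1, y.2⟩
        invFun := fun z => ⟨x * z.1, by simp⟩
        left_inv := fun y => by simp
        right_inv := fun z => by simp }
    -- A coset has p-power size, so a permutation of it with trivial q-th power has a fixed point.
    -- Fixed points and the Frattini subgroup therefore generate Q, and the Frattini part can be
    -- dropped.
    have hcard : ¬ q ∣ Fintype.card {y : Q // x⁻¹ * y ∈ frattini Q} := by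
      obtain ⟨j, hj⟩ := IsPGroup.iff_card.1 (hQ.to_subgroup (frattini Q))
      rw [← Nat.card_eq_fintype_card, Nat.card_congr e, hj]
      exact fun h => hqp ((Nat.prime_dvd_prime_iff_eq hq Fact.out).1 (hq.dvd_of_dvd_pow h))
    have hσ : ∀ y, x⁻¹ * γ.toEquiv y ∈ frattini Q ↔ x⁻¹ * y ∈ frattini Q := by
      intro y
      have h := hpow (orderOf A / q) y
      have heq : x⁻¹ * γ y = x⁻¹ * y * (y⁻¹ * γ y) := by group
      change x⁻¹ * γ y ∈ _ ↔ _
      rw [heq, Subgroup.mul_mem_cancel_right _ h]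
    obtain ⟨y, hy⟩ := Equiv.Perm.exists_fixed_point_of_prime (n := 1) hcard
      (σ := Equiv.Perm.subtypePerm γ.toEquiv hσ) (by
        rw [pow_one, Equiv.Perm.subtypePerm_pow]
        ext z
        have : (γ.toEquiv ^ q : Equiv.Perm Q) = (MulAut.toPerm Q) (γ ^ q) := by
          rw [map_pow]; rfl
        refine (DFunLike.congr_fun this z.1).trans ?_
        rw [hγq]
        rfl)
    have hy' : γ y.1 = y.1 := congr_arg Subtype.val hy
    have hx : x = y.1 * (x⁻¹ * y.1)⁻¹ := by group
    rw [hx]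
    exact mul_mem (Subgroup.mem_sup_left hy') (Subgroup.mem_sup_right (inv_mem y.2))
  have htop := frattini_nongenerating hfix
  have h1 : γ = 1 := by
    ext x
    exact (htop ▸ Subgroup.mem_top x : x ∈ MonoidHom.eqLocus γ.toMonoidHom (MonoidHom.id Q))
  have hdvd := orderOf_dvd_of_pow_eq_one (hγ ▸ h1)
  have hlt : orderOf A / q < orderOf A := Nat.div_lt_self (orderOf_pos A) hq.one_lt
  have hpos : 0 < orderOf A / q := Nat.div_pos (Nat.le_of_dvd (orderOf_pos A) hqn) hq.pos
  exact absurd (Nat.le_of_dvd hpos hdvd) (not_le.2 hlt)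

theorem isResiduallyP_of_forall_hom {p : ℕ} [Fact p.Prime] {G : Type*} [Group G]
    (h : ∀ g : G, g ≠ 1 → ∃ (R : Type) (_ : Group R) (_ : Finite R) (ρ : G →* R),
      IsPGroup p R ∧ ρ g ≠ 1) : IsResiduallyP p G := by
  intro g hg
  obtain ⟨R, _, _, ρ, hR, hρ⟩ := h g hg
  refine ⟨ρ.ker, inferInstance, ?_, hρ⟩
  rw [Subgroup.index_ker]
  exact IsPGroup.iff_card.1 (hR.to_subgroup ρ.range)

theorem IsResiduallyP.of_mulEquiv {p : ℕ} {G H : Type*} [Group G] [Group H] (e : G ≃* H)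
    (h : IsResiduallyP p G) : IsResiduallyP p H := by
  intro g hg
  obtain ⟨N, hN, ⟨k, hk⟩, hgN⟩ := h (e.symm g) (by simpa using hg)
  refine ⟨N.comap e.symm.toMonoidHom, inferInstance, ⟨k, ?_⟩, hgN⟩
  rw [Subgroup.index_comap_of_surjective N e.symm.surjective, hk]

/-- The semidirect product `F₃ ⋊ ℤ` in which the generator of `ℤ` acts by `α`. -/
abbrev FreeByCyclic (α : MulAut (FreeGroup (Fin 3))) : Type :=
  FreeGroup (Fin 3) ⋊[zpowersHom (MulAut (FreeGroup (Fin 3))) α] Multiplicative ℤ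

/-! ### Residual properties when α rotates the basis of the abelianization -/

section Cycle

variable {α : MulAut (FreeGroup (Fin 3))} {s : Fin 3}

/-- The hypothesis covers every commutative target and every χ, so it can be applied to χ ∘ α^n,
which peels off one α at a time. -/
theorem hom_pow_apply_of
    (hα : ∀ (T : Type) [CommGroup T] (χ : FreeGroup (Fin 3) →* T) (i : Fin 3),
      χ (α (FreeGroup.of i)) = χ (FreeGroup.of (i + s)))
    {T : Type} [CommGroup T] (χ : FreeGroup (Fin 3) →* T) (n : ℕ) (i : Fin 3) :
    χ ((α ^ n) (FreeGroup.of i)) = χ (FreeGroup.of (i + n • s)) := by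
  induction n generalizing i with
  | zero => simp
  | succ n ih =>
    have h := hα T (χ.comp (α ^ n).toMonoidHom) i
    rw [pow_succ, MulAut.mul_apply]
    refine h.trans ?_
    refine (ih (i + s)).trans ?_
    rw [succ_nsmul', add_assoc]

/-- The image of the free group is in fact cyclic, generated by the image of one basis element:
otherwise a maximal subgroup would contain that element, and the rotation would force it to contain
all three. -/
theorem commute_of_isPGroup (hs : s ≠ 0)
    (hα : ∀ (T : Type) [CommGroup T] (χ : FreeGroup (Fin 3) →* T) (i : Fin 3),
      χ (α (FreeGroup.of i)) = χ (FreeGroup.of (i + s)))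
    {p : ℕ} [Fact p.Prime] (hp : p ≠ 3) {R : Type} [Group R] [Finite R] (hR : IsPGroup p R)
    (ρ : FreeByCyclic α →* R) :
    Commute (ρ (SemidirectProduct.inl (FreeGroup.of 0)))
      (ρ (SemidirectProduct.inl (FreeGroup.of 1))) := by
  set π : FreeGroup (Fin 3) →* R := ρ.comp SemidirectProduct.inl with hπ
  have hP : IsPGroup p π.range := hR.to_subgroup _
  let x : π.range := π.rangeRestrict (FreeGroup.of 0)
  let y : π.range := π.rangeRestrict (FreeGroup.of 1)
  suffices h : Subgroup.zpowers x = ⊤ by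
    have hy : y ∈ Subgroup.zpowers x := h ▸ Subgroup.mem_top y
    obtain ⟨k, hk⟩ := hy
    have hc : Commute x y := by
      rw [← hk]
      exact (Commute.refl x).zpow_right k
    exact congr_arg Subtype.val hc.eq
  by_contra hne
  obtain ⟨M, hM, hle⟩ := (eq_top_or_exists_le_coatom (Subgroup.zpowers x)).resolve_left hne
  obtain ⟨T, _, q, hq⟩ := hP.exists_commGroup_hom_ker_eq hM
  let χ : FreeGroup (Fin 3) →* T := q.comp π.rangeRestrict
  have hχ0 : χ (FreeGroup.of 0) = 1 := by
    have : x ∈ q.ker := hq ▸ hle (Subgroup.mem_zpowers x)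
    exact this
  -- The stable letter has p-power order in R; conjugation by that power is trivial there, so π
  -- cannot distinguish α^(p^m) f from f.
  obtain ⟨m, hm⟩ := hR (ρ (SemidirectProduct.inr (Multiplicative.ofAdd 1)))
  have hπα : ∀ f, π ((α ^ p ^ m) f) = π f := by
    intro f
    have h := SemidirectProduct.inl_aut (φ := zpowersHom (MulAut (FreeGroup (Fin 3))) α)
      (Multiplicative.ofAdd ((p ^ m : ℕ) : ℤ)) f
    have h2 := congr_arg ρ h
    have ht : ρ (SemidirectProduct.inr (Multiplicative.ofAdd ((p ^ m : ℕ) : ℤ))) = 1 := by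
      rw [← hm, ← map_pow, ← map_pow, ← ofAdd_nsmul]
      simp
    rw [map_mul, map_mul, map_inv, map_inv, ht, one_mul, inv_one, mul_one] at h2
    have h3 : (zpowersHom (MulAut (FreeGroup (Fin 3))) α)
        (Multiplicative.ofAdd ((p ^ m : ℕ) : ℤ)) = α ^ p ^ m := by
      rw [zpowersHom_apply, toAdd_ofAdd, zpow_natCast]
    rw [h3] at h2
    exact h2
  have hχ : ∀ i, χ (FreeGroup.of (i + p ^ m • s)) = χ (FreeGroup.of i) := by
    intro i
    rw [← hom_pow_apply_of hα χ]
    exact congr_arg q (Subtype.ext (hπα _))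
  -- Here p ≠ 3 enters: p^m is invertible modulo 3, so the shift remains nontrivial and its
  -- multiples reach every index.
  have hs' : p ^ m • s ≠ 0 := by
    have h3 : ¬ 3 ∣ p ^ m := fun h => hp
      ((Nat.prime_dvd_prime_iff_eq Nat.prime_three Fact.out).1
        (Nat.prime_three.dvd_of_dvd_pow h)).symm
    generalize p ^ m = n at h3
    have h4 : n • s = (n % 3) • s := by
      conv_lhs => rw [← Nat.mod_add_div n 3, add_nsmul, mul_comm, mul_nsmul]
      have : ∀ a : Fin 3, 3 • a = 0 := by decide
      rw [this, add_zero]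
    have h5 : n % 3 = 1 ∨ n % 3 = 2 := by omega
    have h6 : ∀ a : Fin 3, a ≠ 0 → 1 • a ≠ 0 ∧ 2 • a ≠ 0 := by decide
    rw [h4]
    rcases h5 with h | h <;> rw [h]
    exacts [(h6 s hs).1, (h6 s hs).2]
  generalize p ^ m • s = s' at hχ hs'
  have hall : ∀ i, χ (FreeGroup.of i) = 1 := by
    have h1 := (hχ 0).trans hχ0
    have h2 := (hχ (0 + s')).trans h1
    intro i
    have h3 : ∀ a : Fin 3, a ≠ 0 → ∀ i, i = 0 ∨ i = 0 + a ∨ i = 0 + a + a := by decide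
    rcases h3 s' hs' i with rfl | rfl | rfl
    exacts [hχ0, h1, h2]
  have hχ1 : χ = 1 := FreeGroup.ext_hom _ _ hall
  refine hM.1 (eq_top_iff.2 fun z _ => ?_)
  obtain ⟨f, rfl⟩ := π.rangeRestrict_surjective z
  rw [← hq]
  exact DFunLike.congr_fun hχ1 f

theorem not_isResiduallyP_freeByCyclic (hs : s ≠ 0)
    (hα : ∀ (T : Type) [CommGroup T] (χ : FreeGroup (Fin 3) →* T) (i : Fin 3),
      χ (α (FreeGroup.of i)) = χ (FreeGroup.of (i + s)))
    {p : ℕ} [Fact p.Prime] (hp : p ≠ 3) : ¬ IsResiduallyP p (FreeByCyclic α) := by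
  intro h
  let a : FreeGroup (Fin 3) := FreeGroup.of 0
  let b : FreeGroup (Fin 3) := FreeGroup.of 1
  let c : FreeByCyclic α := SemidirectProduct.inl (a * b * a⁻¹ * b⁻¹)
  have hc : c ≠ 1 := by
    intro h1
    have h2 : a * b * a⁻¹ * b⁻¹ = 1 :=
      SemidirectProduct.inl_injective (h1.trans (map_one SemidirectProduct.inl).symm)
    have h3 := congr_arg FreeGroup.toWord h2
    revert h3
    decide
  obtain ⟨N, hN, ⟨k, hk⟩, hcN⟩ := h c hc
  have hpos : N.index ≠ 0 := by
    rw [hk]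
    exact pow_ne_zero _ (Fact.out : p.Prime).ne_zero
  have : Finite (FreeByCyclic α ⧸ N) := (Nat.card_ne_zero.1 hpos).2
  have hR : IsPGroup p (FreeByCyclic α ⧸ N) := IsPGroup.of_card hk
  have hcomm := commute_of_isPGroup hs hα hp hR (QuotientGroup.mk' N)
  apply hcN
  rw [← QuotientGroup.ker_mk' N, MonoidHom.mem_ker]
  simp only [c, map_mul, map_inv]
  rw [hcomm.eq, mul_inv_cancel_right, mul_inv_cancel]

/-- A 3-quotient of the free group extends over ℤ once its kernel is α-stable and α acts on it with
order a power of 3. The first is arranged by intersecting all kernels of maps to P, the second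
follows because α³ is trivial modulo every maximal subgroup. -/
theorem isResiduallyP_three_freeByCyclic
    (hα : ∀ (T : Type) [CommGroup T] (χ : FreeGroup (Fin 3) →* T) (i : Fin 3),
      χ (α (FreeGroup.of i)) = χ (FreeGroup.of (i + s))) :
    IsResiduallyP 3 (FreeByCyclic α) := by
  have : Fact (Nat.Prime 3) := ⟨Nat.prime_three⟩
  refine isResiduallyP_of_forall_hom fun g hg => ?_
  by_cases hn : g.right = 1
  swap
  -- With m the absolute value of the degree, 3^m > m > 0, so the degree is nonzero modulo 3^m.
  · have hn' : g.right.toAdd ≠ 0 := hn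
    set m := g.right.toAdd.natAbs
    have : NeZero (3 ^ m) := ⟨by positivity⟩
    refine ⟨Multiplicative (ZMod (3 ^ m)), inferInstance, inferInstance,
      (AddMonoidHom.toMultiplicative (Int.castAddHom (ZMod (3 ^ m)))).comp
        SemidirectProduct.rightHom, IsPGroup.of_card (n := m) (by simp), ?_⟩
    intro h
    have h1 : ((g.right.toAdd : ℤ) : ZMod (3 ^ m)) = 0 := h
    rw [ZMod.intCast_zmod_eq_zero_iff_dvd, Int.natCast_dvd] at h1
    exact absurd (Nat.le_of_dvd (Int.natAbs_pos.2 hn') h1) (not_le.2 (Nat.lt_pow_self (by norm_num)))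
  · obtain ⟨f, n⟩ := g
    obtain rfl : n = 1 := hn
    have hf : f ≠ 1 := by rintro rfl; exact hg rfl
    obtain ⟨P, _, _, ρ₀, hP, hρ₀⟩ := exists_three_group_quotient hf
    -- There are finitely many maps to P, so their common kernel has finite index; precomposition
    -- with α permutes them, which makes that kernel α-stable.
    have : Finite (FreeGroup (Fin 3) →* P) := Finite.of_equiv _ FreeGroup.lift
    let ρ : FreeGroup (Fin 3) →* ((FreeGroup (Fin 3) →* P) → P) := MonoidHom.pi fun ψ => ψ
    have hker : ∀ f, f ∈ ρ.ker ↔ ∀ ψ : FreeGroup (Fin 3) →* P, ψ f = 1 := by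
      intro f
      rw [MonoidHom.mem_ker, funext_iff]
      rfl
    have hK : ρ.ker.map α.toMonoidHom = ρ.ker := by
      ext f
      rw [Subgroup.mem_map_equiv (f := α), hker, hker]
      constructor
      · intro h ψ
        have := h (ψ.comp α.toMonoidHom)
        simpa using this
      · exact fun h ψ => h (ψ.comp α.symm.toMonoidHom)
    let A : MulAut (FreeGroup (Fin 3) ⧸ ρ.ker) := QuotientGroup.congr ρ.ker ρ.ker α hK
    have hA : ∀ f : FreeGroup (Fin 3), A (QuotientGroup.mk' ρ.ker f) =
        QuotientGroup.mk' ρ.ker (α f) := fun f => rfl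
    let e : (FreeGroup (Fin 3) ⧸ ρ.ker) ≃* ρ.range := QuotientGroup.quotientKerEquivRange ρ
    have : Finite (FreeGroup (Fin 3) ⧸ ρ.ker) := Finite.of_equiv _ e.symm.toEquiv
    have hpi : IsPGroup 3 ((FreeGroup (Fin 3) →* P) → P) := by
      obtain ⟨k, hk⟩ := IsPGroup.iff_card.1 hP
      intro x
      refine ⟨k, funext fun ψ => ?_⟩
      rw [Pi.pow_apply, ← hk, pow_card_eq_one', Pi.one_apply]
    have hQ : IsPGroup 3 (FreeGroup (Fin 3) ⧸ ρ.ker) :=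
      (hpi.to_subgroup ρ.range).of_equiv e.symm
    obtain ⟨m, hm⟩ := hQ.exists_mulAut_pow_eq_one (A ^ 3) (by
      intro M hM x
      obtain ⟨f, rfl⟩ := QuotientGroup.mk'_surjective ρ.ker x
      obtain ⟨T, _, q, hq⟩ := hQ.exists_commGroup_hom_ker_eq hM
      have h3 : (A ^ 3) (QuotientGroup.mk' ρ.ker f) = QuotientGroup.mk' ρ.ker ((α ^ 3) f) := rfl
      rw [← hq, MonoidHom.mem_ker, h3, map_mul, map_inv, inv_mul_eq_one]
      let χ : FreeGroup (Fin 3) →* T := q.comp (QuotientGroup.mk' ρ.ker)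
      have hχ : χ = χ.comp (α ^ 3).toMonoidHom := by
        refine FreeGroup.ext_hom _ _ fun i => ?_
        have := hom_pow_apply_of hα χ 3 i
        refine Eq.trans ?_ this.symm
        have h0 : ∀ a : Fin 3, 3 • a = 0 := by decide
        rw [h0, add_zero]
      exact DFunLike.congr_fun hχ f)
    rw [← pow_mul, ← pow_succ'] at hm
    have hZ : ∃ k, Nat.card (Subgroup.zpowers A) = 3 ^ k := by
      rw [Nat.card_zpowers]
      obtain ⟨k, _, hk⟩ := (Nat.dvd_prime_pow Nat.prime_three).1 (orderOf_dvd_of_pow_eq_one hm)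
      exact ⟨k, hk⟩
    obtain ⟨k, hk⟩ := hZ
    obtain ⟨l, hl⟩ := IsPGroup.iff_card.1 hQ
    have hfinZ : Finite (Subgroup.zpowers A) :=
      (Nat.card_ne_zero.1 (by rw [hk]; positivity)).2
    let gen : Subgroup.zpowers A := ⟨A, Subgroup.mem_zpowers A⟩
    have hzpow : ∀ n : ℤ, ∀ f : FreeGroup (Fin 3),
        (A ^ n) (QuotientGroup.mk' ρ.ker f) = QuotientGroup.mk' ρ.ker ((α ^ n) f) := by
      have hinv : ∀ f : FreeGroup (Fin 3),
          A⁻¹ (QuotientGroup.mk' ρ.ker f) = QuotientGroup.mk' ρ.ker (α⁻¹ f) := fun f => rfl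
      intro n
      induction n using Int.induction_on with
      | zero => simp
      | succ n ih => intro f; rw [zpow_add_one, zpow_add_one, MulAut.mul_apply, hA, ih]; rfl
      | pred n ih => intro f; rw [zpow_sub_one, zpow_sub_one, MulAut.mul_apply, hinv, ih]; rfl
    let Φ : FreeByCyclic α →*
        (FreeGroup (Fin 3) ⧸ ρ.ker) ⋊[(Subgroup.zpowers A).subtype] (Subgroup.zpowers A) :=
      SemidirectProduct.map (QuotientGroup.mk' ρ.ker) (zpowersHom _ gen) (by
        intro n
        ext f
        have := (hzpow n.toAdd (FreeGroup.of f)).symm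
        simpa [zpowersHom_apply, gen] using this)
    have hcard : Nat.card ((FreeGroup (Fin 3) ⧸ ρ.ker) ⋊[(Subgroup.zpowers A).subtype]
        (Subgroup.zpowers A)) = 3 ^ (l + k) := by
      rw [SemidirectProduct.card, hl, hk, pow_add]
    refine ⟨_, inferInstance, (Nat.card_ne_zero.1 (by rw [hcard]; positivity)).2, Φ,
      IsPGroup.of_card hcard, fun h => ?_⟩
    have h1 : QuotientGroup.mk' ρ.ker f = 1 := congr_arg SemidirectProduct.left h
    rw [← MonoidHom.mem_ker, QuotientGroup.ker_mk', hker] at h1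
    exact hρ₀ (h1 ρ₀)

theorem isResiduallyP_freeByCyclic_iff (hs : s ≠ 0)
    (hα : ∀ (T : Type) [CommGroup T] (χ : FreeGroup (Fin 3) →* T) (i : Fin 3),
      χ (α (FreeGroup.of i)) = χ (FreeGroup.of (i + s))) {p : ℕ} (hp : p.Prime) :
    IsResiduallyP p (FreeByCyclic α) ↔ p = 3 := by
  have : Fact p.Prime := ⟨hp⟩
  refine ⟨fun h => by_contra fun hne => not_isResiduallyP_freeByCyclic hs hα hne h, ?_⟩
  rintro rfl
  exact isResiduallyP_three_freeByCyclic hα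

end Cycle

/-! ### Fundamental groups of unions of two simply connected open sets -/

section UnionOfTwo

variable {X : Type*} [TopologicalSpace X]

namespace Path.Homotopic.Quotient

variable {x y z : X}

theorem trans_symm_cancel_left (p : Path.Homotopic.Quotient x y)
    (q : Path.Homotopic.Quotient x z) : p.trans (p.symm.trans q) = q := by
  rw [← trans_assoc, trans_symm, refl_trans]

theorem symm_trans_cancel_left (p : Path.Homotopic.Quotient x y)
    (q : Path.Homotopic.Quotient y z) : p.symm.trans (p.trans q) = q := by
  rw [← trans_assoc, symm_trans, refl_trans]

theorem trans_left_cancel (p : Path.Homotopic.Quotient x y) {q q' : Path.Homotopic.Quotient y z}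
    (h : p.trans q = p.trans q') : q = q' := by
  rw [← symm_trans_cancel_left p q, h, symm_trans_cancel_left]

theorem symm_trans_rev (p : Path.Homotopic.Quotient x y) (q : Path.Homotopic.Quotient y z) :
    (p.trans q).symm = q.symm.trans p.symm := by
  apply trans_left_cancel (p.trans q)
  rw [trans_symm, trans_assoc, trans_symm_cancel_left, trans_symm]

theorem refl_symm : (Path.Homotopic.Quotient.refl x).symm = .refl x := by
  apply trans_left_cancel (.refl x)
  rw [trans_symm, trans_refl]

end Path.Homotopic.Quotient

/-- A property of homotopy classes of paths that is stable under concatenation and holds for paths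
inside the members of an open cover holds for all paths. -/
theorem Path.Homotopic.Quotient.induction_of_openCover {ι : Type*} {U : ι → Set X}
    (hU : ∀ i, IsOpen (U i)) (hcover : ∀ x, ∃ i, x ∈ U i)
    (P : ∀ x y : X, Path.Homotopic.Quotient x y → Prop)
    (htrans : ∀ x y z (p : Path.Homotopic.Quotient x y) (q : Path.Homotopic.Quotient y z),
      P x y p → P y z q → P x z (p.trans q))
    (hmem : ∀ i x y (γ : Path x y), (∀ t, γ t ∈ U i) → P x y (.mk γ))
    {x y : X} (γ : Path.Homotopic.Quotient x y) : P x y γ := by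
  induction γ using Path.Homotopic.Quotient.ind with | mk γ =>
  obtain ⟨t, t0, tmono, ⟨n, hn⟩, hsub⟩ := exists_monotone_Icc_subset_open_cover_unitInterval
    (fun i => (hU i).preimage γ.continuous)
    (fun s _ => Set.mem_iUnion.2 (hcover (γ s)))
  have hstep : ∀ k, P _ _ (.mk (γ.subpath (t k) (t (k + 1)))) := by
    intro k
    obtain ⟨i, hi⟩ := hsub k
    refine hmem i _ _ _ fun s => ?_
    have : γ.subpath (t k) (t (k + 1)) s ∈ Set.range (γ.subpath (t k) (t (k + 1))) := ⟨s, rfl⟩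
    rw [Path.range_subpath_of_le _ _ _ (tmono k.le_succ)] at this
    obtain ⟨r, hr, hr'⟩ := this
    rw [← hr']
    exact hi hr
  have hall : ∀ k, P _ _ (.mk (γ.subpath (t 0) (t (k + 1)))) := by
    intro k
    induction k with
    | zero => exact hstep 0
    | succ k ih =>
      have h := htrans _ _ _ _ _ ih (hstep (k + 1))
      rw [← Path.Homotopic.Quotient.mk_trans] at h
      rwa [Path.Homotopic.Quotient.eq.2 ⟨Path.Homotopy.subpathTransSubpath γ _ _ _⟩] at h
  have h := hall n
  rw [t0, hn (n + 1) n.le_succ] at h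
  -- The subpath over the whole interval has endpoints γ 0 and γ 1, equal to x and y only
  -- propositionally.
  have key : ∀ (x' y' : X) (hx : x' = x) (hy : y' = y),
      P x' y' (.mk (γ.cast hx hy)) → P x y (.mk γ) := by
    rintro _ _ rfl rfl h
    exact h
  refine key _ _ γ.source γ.target ?_
  rwa [Path.subpath_zero_one] at h

theorem IsSimplyConnected.exists_path {A : Set X} (hA : IsSimplyConnected A) {x y : X}
    (hx : x ∈ A) (hy : y ∈ A) : ∃ γ : Path x y, ∀ t, γ t ∈ A := by
  obtain ⟨γ, hγ⟩ := hA.isPathConnected.joinedIn x hx y hy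
  exact ⟨γ, hγ⟩

theorem IsSimplyConnected.mk_eq_mk {A : Set X} (hA : IsSimplyConnected A) {x y : X}
    {γ γ' : Path x y} (h : ∀ t, γ t ∈ A) (h' : ∀ t, γ' t ∈ A) :
    Path.Homotopic.Quotient.mk γ = Path.Homotopic.Quotient.mk γ' := by
  have := hA.simplyConnectedSpace
  have hx : x ∈ A := by simpa using h 0
  have hy : y ∈ A := by simpa using h 1
  let δ : Path (⟨x, hx⟩ : A) ⟨y, hy⟩ :=
    ⟨⟨fun t => ⟨γ t, h t⟩, by fun_prop⟩, Subtype.ext γ.source, Subtype.ext γ.target⟩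
  let δ' : Path (⟨x, hx⟩ : A) ⟨y, hy⟩ :=
    ⟨⟨fun t => ⟨γ' t, h' t⟩, by fun_prop⟩, Subtype.ext γ'.source, Subtype.ext γ'.target⟩
  have := (SimplyConnectedSpace.paths_homotopic δ δ').map ⟨Subtype.val, continuous_subtype_val⟩
  exact Path.Homotopic.Quotient.eq.2 this

/-- The fundamental group of the union of two simply connected open sets is generated by the loops
crossing the intersection twice. -/
theorem subgroup_eq_top_of_crossing_loops_mem {A B : Set X} (hAo : IsOpen A) (hBo : IsOpen B)
    (hAB : ∀ x, x ∈ A ∨ x ∈ B) (hA : IsSimplyConnected A) (hB : IsSimplyConnected B)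
    {x₀ v₀ : X} (hx₀ : x₀ ∈ A) (hv₀ : v₀ ∈ A ∩ B) {ι : Type*} (v : ι → X)
    (hv : ∀ x ∈ A ∩ B, ∃ j, JoinedIn (A ∩ B) (v j) x)
    (S : Subgroup (FundamentalGroup X x₀))
    (hS : ∀ j (a : Path x₀ (v j)) (b : Path (v j) v₀) (c : Path v₀ x₀), (∀ t, a t ∈ A) →
      (∀ t, b t ∈ B) → (∀ t, c t ∈ A) →
      (FundamentalGroup.fromPath (.mk (a.trans (b.trans c)))) ∈ S) : S = ⊤ := by
  classical
  let cA : ∀ x, x ∈ A → Path x₀ x := fun x hx => (hA.exists_path hx₀ hx).choose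
  have hcA : ∀ x hx t, cA x hx t ∈ A := fun x hx => (hA.exists_path hx₀ hx).choose_spec
  let cB : ∀ x, x ∈ B → Path v₀ x := fun x hx => (hB.exists_path hv₀.2 hx).choose
  have hcB : ∀ x hx t, cB x hx t ∈ B := fun x hx => (hB.exists_path hv₀.2 hx).choose_spec
  -- Two systems of paths from the base point: d enters B through v₀, while c stays in A whenever
  -- its endpoint lies in A. On the overlap they differ by a crossing loop, so closing any path up
  -- with c produces an element of S.
  let d : ∀ x, x ∈ B → Path.Homotopic.Quotient x₀ x := fun x hx =>
    .trans (.mk (cA v₀ hv₀.1)) (.mk (cB x hx))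
  let c : ∀ x, Path.Homotopic.Quotient x₀ x := fun x =>
    if hx : x ∈ A then .mk (cA x hx) else d x ((hAB x).resolve_left hx)
  have hcd : ∀ x (hx : x ∈ B), FundamentalGroup.fromPath ((c x).trans (d x hx).symm) ∈ S := by
    intro x hx
    by_cases hxA : x ∈ A
    · obtain ⟨j, hj⟩ := hv x ⟨hxA, hx⟩
      obtain ⟨w, hw⟩ := hj
      have hvj : v j ∈ A ∩ B := by simpa using hw 0
      have hmem := hS j (cA (v j) hvj.1) (cB (v j) hvj.2).symm (cA v₀ hv₀.1).symm
        (hcA _ hvj.1) (fun t => hcB _ hvj.2 _) (fun t => hcA _ hv₀.1 _)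
      have h1 : Path.Homotopic.Quotient.mk (cA x hxA) = .trans (.mk (cA _ hvj.1)) (.mk w) := by
        rw [← Path.Homotopic.Quotient.mk_trans]
        refine hA.mk_eq_mk (hcA _ ‹_›) fun t => ?_
        rw [Path.trans_apply]
        split_ifs
        exacts [hcA _ hvj.1 _, (hw _).1]
      have h2 : Path.Homotopic.Quotient.mk (cB x hx) = .trans (.mk (cB _ hvj.2)) (.mk w) := by
        rw [← Path.Homotopic.Quotient.mk_trans]
        refine hB.mk_eq_mk (hcB _ ‹_›) fun t => ?_
        rw [Path.trans_apply]
        split_ifs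
        exacts [hcB _ hvj.2 _, (hw _).2]
      convert hmem using 2
      simp only [c, d, dif_pos hxA, h1, h2, Path.Homotopic.Quotient.mk_trans,
        Path.Homotopic.Quotient.mk_symm, Path.Homotopic.Quotient.symm_trans_rev,
        Path.Homotopic.Quotient.trans_assoc, Path.Homotopic.Quotient.trans_symm_cancel_left]
    · simp only [c, dif_neg hxA, Path.Homotopic.Quotient.trans_symm]
      exact one_mem S
  have hdc : ∀ x (hx : x ∈ B), FundamentalGroup.fromPath ((d x hx).trans (c x).symm) ∈ S := by
    intro x hx
    have h := inv_mem (hcd x hx)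
    have heq : (FundamentalGroup.fromPath ((c x).trans (d x hx).symm))⁻¹ =
        FundamentalGroup.fromPath ((d x hx).trans (c x).symm) := by
      rw [inv_eq_iff_mul_eq_one]
      change ((d x hx).trans (c x).symm).trans ((c x).trans (d x hx).symm) =
        Path.Homotopic.Quotient.refl _
      simp only [Path.Homotopic.Quotient.trans_assoc,
        Path.Homotopic.Quotient.symm_trans_cancel_left, Path.Homotopic.Quotient.trans_symm]
    rwa [heq] at h
  -- The group law reverses concatenation: p followed by q is the product of q and p.
  have hmul : ∀ p q : Path.Homotopic.Quotient x₀ x₀, FundamentalGroup.fromPath p ∈ S →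
      FundamentalGroup.fromPath q ∈ S → FundamentalGroup.fromPath (p.trans q) ∈ S :=
    fun p q hp hq => S.mul_mem hq hp
  have hall : ∀ x y (γ : Path.Homotopic.Quotient x y),
      FundamentalGroup.fromPath (((c x).trans γ).trans (c y).symm) ∈ S := by
    intro x y γ
    refine Path.Homotopic.Quotient.induction_of_openCover (U := fun b : Bool => cond b A B)
      (by rintro (_ | _) <;> assumption)
      (fun x => (hAB x).elim (fun h => ⟨true, h⟩) fun h => ⟨false, h⟩)
      (fun x y γ => FundamentalGroup.fromPath (((c x).trans γ).trans (c y).symm) ∈ S) ?_ ?_ γ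
    · intro x y z p q hp hq
      have h := hmul _ _ hp hq
      have heq : (((c x).trans p).trans (c y).symm).trans (((c y).trans q).trans (c z).symm) =
          ((c x).trans (p.trans q)).trans (c z).symm := by
        simp only [Path.Homotopic.Quotient.trans_assoc,
          Path.Homotopic.Quotient.symm_trans_cancel_left]
      rwa [heq] at h
    · rintro (_ | _) x y γ hγ
      · simp only [cond_false] at hγ
        have hx : x ∈ B := by simpa using hγ 0
        have hy : y ∈ B := by simpa using hγ 1
        have h := hmul _ _ (hcd x hx) (hdc y hy)
        have h2 : Path.Homotopic.Quotient.mk (cB y hy) = .trans (.mk (cB x hx)) (.mk γ) := by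
          rw [← Path.Homotopic.Quotient.mk_trans]
          refine hB.mk_eq_mk (hcB _ ‹_›) fun t => ?_
          rw [Path.trans_apply]
          split_ifs
          exacts [hcB _ hx _, hγ _]
        have h3 : d y hy = (d x hx).trans (.mk γ) := by
          simp only [d, h2, Path.Homotopic.Quotient.trans_assoc]
        have heq : ((c x).trans (d x hx).symm).trans ((d y hy).trans (c y).symm) =
            ((c x).trans (.mk γ)).trans (c y).symm := by
          rw [h3]
          simp only [Path.Homotopic.Quotient.trans_assoc,
            Path.Homotopic.Quotient.symm_trans_cancel_left]
        rwa [heq] at h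
      · simp only [cond_true] at hγ
        have hx : x ∈ A := by simpa using hγ 0
        have hy : y ∈ A := by simpa using hγ 1
        have h2 : Path.Homotopic.Quotient.mk (cA y hy) = .trans (.mk (cA x hx)) (.mk γ) := by
          rw [← Path.Homotopic.Quotient.mk_trans]
          refine hA.mk_eq_mk (hcA _ ‹_›) fun t => ?_
          rw [Path.trans_apply]
          split_ifs
          exacts [hcA _ hx _, hγ _]
        simp only [c, dif_pos hx, dif_pos hy, h2, Path.Homotopic.Quotient.trans_symm]
        exact one_mem S
  have hc₀ : c x₀ = .refl x₀ := by
    simp only [c, dif_pos hx₀]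
    rw [← Path.Homotopic.Quotient.mk_refl]
    exact hA.mk_eq_mk (hcA _ hx₀) fun t => by simpa using hx₀
  refine eq_top_iff.2 fun γ _ => ?_
  have h := hall x₀ x₀ γ
  have heq : ((c x₀).trans γ).trans (c x₀).symm = γ := by
    rw [hc₀]
    simp [Path.Homotopic.Quotient.refl_symm]
  rwa [heq] at h

end UnionOfTwo

/-! ### Monodromy of coverings along explicitly lifted paths -/

section Monodromy

variable {E X : Type*} [TopologicalSpace E] [TopologicalSpace X] {p : E → X}

theorem IsCoveringMap.monodromy_mk_of_lift (cov : IsCoveringMap p) {x y : X} (γ : Path x y)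
    {e e' : E} (Γ : Path e e') (h : ∀ t, p (Γ t) = γ t) (he : p e = x) (he' : p e' = y) :
    cov.monodromy (.mk γ) ⟨e, he⟩ = ⟨e', he'⟩ := by
  subst he he'
  refine cov.monodromy_eq_of_map_eq (ex := ⟨e, rfl⟩) (ey := ⟨e', rfl⟩) (.mk Γ) ?_
  rw [← Path.Homotopic.Quotient.mk_map, Path.Homotopic.Quotient.cast_rfl_rfl]
  congr 1
  ext t
  exact h t

theorem IsCoveringMap.monodromy_mk_of_section (cov : IsCoveringMap p) {x y : X} (γ : Path x y)
    {U : Set X} (hγ : ∀ t, γ t ∈ U) {s : X → E} (hs : ContinuousOn s U)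
    (hps : ∀ x ∈ U, p (s x) = x) (hx : p (s x) = x) (hy : p (s y) = y) :
    cov.monodromy (.mk γ) ⟨s x, hx⟩ = ⟨s y, hy⟩ := by
  let Γ : Path (s x) (s y) :=
    ⟨⟨fun t => s (γ t), hs.comp_continuous γ.continuous hγ⟩, by simp, by simp⟩
  exact cov.monodromy_mk_of_lift γ Γ (fun t => hps _ (hγ t)) hx hy

end Monodromy

/-! ### Bundles with discrete fibres glued from two trivial pieces -/

section Gluing

variable {X : Type*} [TopologicalSpace X] {H : Type*} [Group H] [TopologicalSpace H]
  [DiscreteTopology H]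

open Classical in
/-- The `H`-bundle with discrete fibres obtained by gluing trivial bundles over `A` and `B` along
a locally constant function `g` on `A ∩ B`. -/
noncomputable def gluedBundle (A B : Set X) (hA : IsOpen A) (hB : IsOpen B)
    (hAB : ∀ x, x ∈ A ∨ x ∈ B) (g : X → H) (hg : ContinuousOn g (A ∩ B)) :
    FiberBundleCore Bool X H where
  baseSet i := cond i A B
  isOpen_baseSet := by rintro (_ | _) <;> assumption
  indexAt x := decide (x ∈ A)
  mem_baseSet_at x := by
    by_cases h : x ∈ A
    · simp [h]
    · simpa [h] using (hAB x).resolve_left h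
  coordChange i j x h := (cond j 1 (g x))⁻¹ * (cond i 1 (g x) * h)
  coordChange_self i x _ v := by simp
  continuousOn_coordChange i j := by
    have hg1 : ContinuousOn (fun q : X × H => g q.1) ((A ∩ B) ×ˢ Set.univ) :=
      hg.comp continuous_fst.continuousOn fun q hq => hq.1
    have hg2 : ContinuousOn (fun q : X × H => g q.1) ((B ∩ A) ×ˢ Set.univ) := by
      rwa [Set.inter_comm]
    have hmul : Continuous fun q : H × H => q.1 * q.2 := continuous_of_discreteTopology
    have hinv : Continuous fun q : H => q⁻¹ := continuous_of_discreteTopology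
    cases i <;> cases j <;> simp only [cond_true, cond_false, inv_one, one_mul,
      inv_mul_cancel_left]
    · exact continuous_snd.continuousOn
    · exact hmul.comp_continuousOn (hg2.prodMk continuous_snd.continuousOn)
    · exact hmul.comp_continuousOn ((hinv.comp_continuousOn hg1).prodMk
        continuous_snd.continuousOn)
    · exact continuous_snd.continuousOn
  coordChange_comp i j k x _ v := by group

variable {A B : Set X} (hA : IsOpen A) (hB : IsOpen B) (hAB : ∀ x, x ∈ A ∨ x ∈ B) {g : X → H}
  (hg : ContinuousOn g (A ∩ B))

/-- The constant local sections of the glued bundle over `A` (index `true`) and `B`. -/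
noncomputable def gluedSection (i : Bool) (h : H) (x : X) :
    (gluedBundle A B hA hB hAB g hg).TotalSpace :=
  ⟨x, (gluedBundle A B hA hB hAB g hg).coordChange i
    ((gluedBundle A B hA hB hAB g hg).indexAt x) x h⟩

theorem continuousOn_gluedSection (i : Bool) (h : H) :
    ContinuousOn (gluedSection hA hB hAB hg i h) (cond i A B) := by
  have h1 := ((gluedBundle A B hA hB hAB g hg).localTriv i).continuousOn_invFun
  exact h1.comp (f := fun x => (x, h)) (by fun_prop) fun x hx =>
    ((gluedBundle A B hA hB hAB g hg).localTriv i).mem_target.2 hx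

theorem gluedSection_true_eq (h : H) (x : X) :
    gluedSection hA hB hAB hg true h x = gluedSection hA hB hAB hg false ((g x)⁻¹ * h) x := by
  simp only [gluedSection, gluedBundle, cond_true, cond_false]
  congr 2
  group

theorem gluedSection_false_eq (h : H) (x : X) :
    gluedSection hA hB hAB hg false h x = gluedSection hA hB hAB hg true (g x * h) x := by
  rw [gluedSection_true_eq, inv_mul_cancel_left]

theorem gluedSection_true_injective {x : X} :
    Function.Injective fun h => gluedSection hA hB hAB hg true h x := by
  intro h h' hh
  have := (Bundle.TotalSpace.mk_injective x hh)
  simp only [gluedBundle, cond_true, one_mul] at this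
  exact mul_left_cancel this

/-- Constant sections are followed along each piece. Entering B at v multiplies the coordinate on
the left by (g v)⁻¹, and returning to A at w multiplies it by g w. -/
theorem gluedBundle_monodromy_crossing {x₀ v w : X} (a : Path x₀ v) (b : Path v w)
    (c : Path w x₀) (ha : ∀ t, a t ∈ A) (hb : ∀ t, b t ∈ B) (hc : ∀ t, c t ∈ A) (h : H) :
    (FiberBundle.isCoveringMap (F := H)
      (E := (gluedBundle A B hA hB hAB g hg).Fiber)).monodromy
      (.mk (a.trans (b.trans c))) ⟨gluedSection hA hB hAB hg true h x₀, rfl⟩ =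
      ⟨gluedSection hA hB hAB hg true (g w * (g v)⁻¹ * h) x₀, rfl⟩ := by
  rw [Path.Homotopic.Quotient.mk_trans, Path.Homotopic.Quotient.mk_trans,
    IsCoveringMap.monodromy_trans_apply, IsCoveringMap.monodromy_trans_apply,
    IsCoveringMap.monodromy_mk_of_section _ a ha
      (continuousOn_gluedSection hA hB hAB hg true h) (fun _ _ => rfl) rfl rfl]
  simp only [gluedSection_true_eq hA hB hAB hg h v]
  rw [IsCoveringMap.monodromy_mk_of_section _ b hb
      (continuousOn_gluedSection hA hB hAB hg false _) (fun _ _ => rfl) rfl rfl]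
  simp only [gluedSection_false_eq hA hB hAB hg _ w]
  rw [IsCoveringMap.monodromy_mk_of_section _ c hc
      (continuousOn_gluedSection hA hB hAB hg true _) (fun _ _ => rfl) rfl rfl]
  simp only [mul_assoc]

end Gluing

/-- The bundle glued along g has the free group as fibre, and the loop of index j acts on the fibre
at x₀ as left multiplication by the generator j. A word therefore acts by left multiplication by
itself, so a word in the kernel fixes 1 and is trivial. -/
theorem injective_lift_of_crossing_loops {X : Type*} [TopologicalSpace X] {κ : Type*}
    {A B : Set X} (hA : IsOpen A) (hB : IsOpen B) (hAB : ∀ x, x ∈ A ∨ x ∈ B)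
    {g : X → FreeGroup κ} (hg : ∀ x ∈ A ∩ B, ∀ᶠ y in nhds x, g y = g x) {x₀ : X}
    (ℓ : κ → FundamentalGroup X x₀)
    (hℓ : ∀ j, ∃ (v w : X) (a : Path x₀ v) (b : Path v w) (c : Path w x₀), (∀ t, a t ∈ A) ∧
      (∀ t, b t ∈ B) ∧ (∀ t, c t ∈ A) ∧ g w * (g v)⁻¹ = FreeGroup.of j ∧
      ℓ j = FundamentalGroup.fromPath (.mk (a.trans (b.trans c)))) :
    Function.Injective (FreeGroup.lift ℓ) := by
  let _ : TopologicalSpace (FreeGroup κ) := ⊥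
  have : DiscreteTopology (FreeGroup κ) := ⟨rfl⟩
  have hgc : ContinuousOn g (A ∩ B) := fun x hx =>
    (continuousAt_const.congr ((hg x hx).mono fun y hy => hy.symm)).continuousWithinAt
  let cov := FiberBundle.isCoveringMap (F := FreeGroup κ)
    (E := (gluedBundle A B hA hB hAB g hgc).Fiber)
  let e : FreeGroup κ → (Bundle.TotalSpace.proj :
      (gluedBundle A B hA hB hAB g hgc).TotalSpace → X) ⁻¹' {x₀} :=
    fun h => ⟨gluedSection hA hB hAB hgc true h x₀, rfl⟩
  have hgen : ∀ j h, cov.monodromyPerm x₀ (ℓ j) (e h) = e (FreeGroup.of j * h) := by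
    intro j h
    obtain ⟨v, w, a, b, c, ha, hb, hc, hgvw, hl⟩ := hℓ j
    rw [hl, ← hgvw]
    exact gluedBundle_monodromy_crossing hA hB hAB hgc a b c ha hb hc h
  have hall : ∀ f h, cov.monodromyPerm x₀ (FreeGroup.lift ℓ f) (e h) = e (f * h) := by
    intro f
    induction f using FreeGroup.induction_on with
    | C1 => intro h; rw [map_one, map_one, one_mul]; rfl
    | of j => intro h; rw [FreeGroup.lift_apply_of, hgen]
    | inv_of j _ =>
      intro h
      rw [map_inv, map_inv, FreeGroup.lift_apply_of, Equiv.Perm.inv_eq_iff_eq, hgen,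
        mul_inv_cancel_left]
    | mul f f' hf hf' =>
      intro h
      rw [map_mul, map_mul, Equiv.Perm.mul_apply, hf', hf, mul_assoc]
  rw [injective_iff_map_eq_one]
  intro f hf
  have h1 := hall f 1
  rw [hf, map_one, mul_one] at h1
  exact (gluedSection_true_injective hA hB hAB hgc (congr_arg Subtype.val h1)).symm

/-! ### Winding homomorphisms -/

section Winding

variable {X Y : Type*} [TopologicalSpace X] [TopologicalSpace Y]

/-- The homomorphism sending a loop `γ` to the variation of `log (f ∘ γ)`, for a continuous
nonvanishing function `f` with value `1` at the base point. -/
noncomputable def windingHom (f : C(X, {z : ℂ // z ≠ 0})) {x : X} (hx : (f x : ℂ) = 1) :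
    FundamentalGroup X x →* Multiplicative ℂ where
  toFun γ := Multiplicative.ofAdd (Complex.isCoveringMap_exp.monodromy
    (FundamentalGroup.map f x γ) ⟨0, Subtype.ext (by simp [hx])⟩ : ℂ)
  map_one' := by
    rw [map_one, FundamentalGroup.one_def, IsCoveringMap.monodromy_refl]
    rfl
  map_mul' γ γ' := by
    let e : (fun z : ℂ ↦ (⟨_, z.exp_ne_zero⟩ : {z : ℂ // z ≠ 0})) ⁻¹' {f x} :=
      ⟨0, Subtype.ext (by simp [hx])⟩
    -- Deck transformations of exp are translations, so the endpoint of the lift starting at 0 is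
    -- the translation vector, and these vectors add.
    let F := Complex.isAddQuotientCoveringMap_exp.fundamentalGroupToMulOpposite e
    have hF : ∀ δ, (Complex.isCoveringMap_exp.monodromy δ e : ℂ) = ((F δ).unop.toAdd : ℂ) := by
      intro δ
      have h := Complex.isAddQuotientCoveringMap_exp.unop_fundamentalGroupToMulOpposite_smul
        (e := e) (γ := δ)
      rw [← h]
      change ((F δ).unop.toAdd : ℂ) + 0 = _
      rw [add_zero]
    change Multiplicative.ofAdd (Complex.isCoveringMap_exp.monodromy _ e : ℂ) =
      Multiplicative.ofAdd (Complex.isCoveringMap_exp.monodromy _ e : ℂ) *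
      Multiplicative.ofAdd (Complex.isCoveringMap_exp.monodromy _ e : ℂ)
    rw [hF, hF, hF, map_mul, map_mul, MulOpposite.unop_mul, toAdd_mul, AddSubgroup.coe_add,
      ofAdd_add, mul_comm]

theorem windingHom_mapOfEq (f : C(Y, {z : ℂ // z ≠ 0})) (h : C(X, Y)) {x : X} {y : Y}
    (hxy : h x = y) (hy : (f y : ℂ) = 1) (hx : ((f.comp h) x : ℂ) = 1)
    (γ : FundamentalGroup X x) :
    windingHom f hy (FundamentalGroup.mapOfEq h hxy γ) = windingHom (f.comp h) hx γ := by
  subst hxy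
  rw [FundamentalGroup.mapOfEq_apply]
  simp only [windingHom, MonoidHom.coe_mk, OneHom.coe_mk]
  rw [Path.Homotopic.Quotient.cast_rfl_rfl]
  congr 2
  have h1 : FundamentalGroup.map f (h x) (Path.Homotopic.Quotient.map γ h) =
    FundamentalGroup.map (f.comp h) x γ := (Path.Homotopic.Quotient.map_comp (p := γ)).symm
  rw [h1]

theorem windingHom_eq_of_homotopy {f g : C(X, {z : ℂ // z ≠ 0})} {x : X}
    (hf : (f x : ℂ) = 1) (hg : (g x : ℂ) = 1) (H : f.HomotopyRel g {x}) :
    windingHom f hf = windingHom g hg := by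
  ext γ
  induction γ using Path.Homotopic.Quotient.ind with | mk γ =>
  have hrel : ((γ.map f.continuous : Path _ _) : C(unitInterval, {z : ℂ // z ≠ 0})).HomotopicRel
      (γ.map g.continuous : Path _ _) {0, 1} := by
    refine ⟨⟨⟨⟨fun s => H (s.1, γ s.2), by fun_prop⟩, fun t => ?_, fun t => ?_⟩, ?_⟩⟩
    · simp
    · simp
    · rintro t s (rfl | rfl)
      · simpa using H.eq_fst t rfl
      · simpa using H.eq_fst t rfl
  exact congr_arg Multiplicative.ofAdd
    (Complex.isCoveringMap_exp.liftPath_apply_one_eq_of_homotopicRel hrel 0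
      (Subtype.ext (by simp [hf])) (Subtype.ext (by simp [hg])))

/-- The value of a winding homomorphism on a loop that is covered by two domains on which a branch
of the logarithm exists. -/
theorem windingHom_crossing (f : C(X, {z : ℂ // z ≠ 0})) {x₀ v w : X} (hx : (f x₀ : ℂ) = 1)
    {A B : Set X} {LA LB : X → ℂ} (hLA : ContinuousOn LA A) (hLB : ContinuousOn LB B) {k : ℂ}
    (hA : ∀ x ∈ A, Complex.exp (LA x) = k * f x) (hB : ∀ x ∈ B, Complex.exp (LB x) = k * f x)
    (a : Path x₀ v) (b : Path v w) (c : Path w x₀) (ha : ∀ t, a t ∈ A) (hb : ∀ t, b t ∈ B)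
    (hc : ∀ t, c t ∈ A) :
    windingHom f hx (FundamentalGroup.fromPath (.mk (a.trans (b.trans c)))) =
      Multiplicative.ofAdd ((LA v - LB v) - (LA w - LB w)) := by
  have hx₀ : x₀ ∈ A := by simpa using ha 0
  have hvA : v ∈ A := by simpa using ha 1
  have hvB : v ∈ B := by simpa using hb 0
  have hwB : w ∈ B := by simpa using hb 1
  have hwA : w ∈ A := by simpa using hc 0
  have hk : Complex.exp (LA x₀) = k := by rw [hA x₀ hx₀, hx, mul_one]
  have hk0 : k ≠ 0 := hk ▸ Complex.exp_ne_zero _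
  -- On a domain with a branch L of log (k f), a lift of f along γ varies by the increment of L; the
  -- constant k cancels.
  have key : ∀ {y z : X} (γ : Path y z) (U : Set X) (L : X → ℂ), ContinuousOn L U →
      (∀ x ∈ U, Complex.exp (L x) = k * f x) → (∀ t, γ t ∈ U) → ∀ (e e' : ℂ)
      (he : (⟨_, e.exp_ne_zero⟩ : {z : ℂ // z ≠ 0}) = f y)
      (he' : (⟨_, e'.exp_ne_zero⟩ : {z : ℂ // z ≠ 0}) = f z), e' = e + (L z - L y) →
      Complex.isCoveringMap_exp.monodromy (.mk (γ.map f.continuous)) ⟨e, he⟩ = ⟨e', he'⟩ := by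
    intro y z γ U L hL hexp hγ e e' he he' heq
    let Γ : Path e e' :=
      ⟨⟨fun t => e + (L (γ t) - L y), by
        have := hL.comp_continuous γ.continuous hγ
        exact continuous_const.add (this.sub continuous_const)⟩, by simp, by simp [heq]⟩
    refine Complex.isCoveringMap_exp.monodromy_mk_of_lift _ Γ (fun t => Subtype.ext ?_) he he'
    have hy : y ∈ U := by simpa using hγ 0
    have h1 : Complex.exp e = f y := congr_arg Subtype.val he
    change Complex.exp (e + (L (γ t) - L y)) = f (γ t)
    rw [Complex.exp_add, Complex.exp_sub, h1, hexp _ (hγ t), hexp _ hy]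
    have := (f y).2
    field_simp
  have h1 : Complex.exp (LA v - LA x₀) = f v := by
    rw [Complex.exp_sub, hA _ hvA, hk, mul_div_cancel_left₀ _ hk0]
  have h2 : Complex.exp (LA v - LA x₀ + (LB w - LB v)) = f w := by
    have := (f v).2
    rw [Complex.exp_add, h1, Complex.exp_sub, hB _ hwB, hB _ hvB]
    field_simp
  have h3 : Complex.exp ((LA v - LB v) - (LA w - LB w)) = f x₀ := by
    have := (f w).2
    have h4 : (LA v - LB v) - (LA w - LB w) =
      (LA v - LA x₀ + (LB w - LB v)) + (LA x₀ - LA w) := by ring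
    rw [h4, Complex.exp_add, h2, Complex.exp_sub, hA _ hx₀, hA _ hwA]
    field_simp
  change Multiplicative.ofAdd (Complex.isCoveringMap_exp.monodromy
    (.mk ((a.trans (b.trans c)).map f.continuous)) _ : ℂ) = _
  rw [Path.map_trans, Path.map_trans, Path.Homotopic.Quotient.mk_trans,
    Path.Homotopic.Quotient.mk_trans, IsCoveringMap.monodromy_trans_apply,
    IsCoveringMap.monodromy_trans_apply,
    key a A LA hLA hA ha 0 _ _ (Subtype.ext h1) (by ring),
    key b B LB hLB hB hb _ _ _ (Subtype.ext h2) rfl,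
    key c A LA hLA hA hc _ _ _ (Subtype.ext h3) (by ring)]

end Winding

/-- Loops crossing between consecutive components of the intersection of two simply connected open
sets generate the fundamental group of the union. -/
theorem subgroup_eq_top_of_consecutive_loops_mem {X : Type*} [TopologicalSpace X] {A B : Set X}
    (hAo : IsOpen A) (hBo : IsOpen B)
    (hAB : ∀ x, x ∈ A ∨ x ∈ B) (hA : IsSimplyConnected A) (hB : IsSimplyConnected B)
    {x₀ : X} (hx₀ : x₀ ∈ A) {n : ℕ} (v : Fin (n + 1) → X) (hvAB : ∀ j, v j ∈ A ∩ B)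
    (hv : ∀ x ∈ A ∩ B, ∃ j, JoinedIn (A ∩ B) (v j) x)
    (S : Subgroup (FundamentalGroup X x₀))
    (hS : ∀ j : Fin n, ∃ (a : Path x₀ (v j.castSucc)) (b : Path (v j.castSucc) (v j.succ))
      (c : Path (v j.succ) x₀), (∀ t, a t ∈ A) ∧ (∀ t, b t ∈ B) ∧ (∀ t, c t ∈ A) ∧
      (FundamentalGroup.fromPath (.mk (a.trans (b.trans c)))) ∈ S) : S = ⊤ := by
  refine subgroup_eq_top_of_crossing_loops_mem hAo hBo hAB hA hB hx₀ (hvAB 0) v hv S ?_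
  intro j
  induction j using Fin.induction with
  | zero =>
    intro a b c ha hb hc
    -- For the index 0 the middle path is a loop in the simply connected set B, and the outer two
    -- paths cancel in A.
    have hb1 : Path.Homotopic.Quotient.mk b = .refl _ := by
      rw [← Path.Homotopic.Quotient.mk_refl]
      exact hB.mk_eq_mk hb fun t => (hvAB 0).2
    have ha1 : Path.Homotopic.Quotient.mk a = .symm (.mk c) := by
      rw [← Path.Homotopic.Quotient.mk_symm]
      exact hA.mk_eq_mk ha fun t => hc _
    rw [Path.Homotopic.Quotient.mk_trans, Path.Homotopic.Quotient.mk_trans, hb1, ha1,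
      Path.Homotopic.Quotient.refl_trans, Path.Homotopic.Quotient.symm_trans]
    exact one_mem S
  | succ j ih =>
    intro a b c ha hb hc
    obtain ⟨a', b', c', ha', hb', hc', hmem⟩ := hS j
    obtain ⟨b'', hb''⟩ := hB.exists_path (hvAB j.castSucc).2 (hvAB 0).2
    have ha1 : Path.Homotopic.Quotient.mk a = .symm (.mk c') := by
      rw [← Path.Homotopic.Quotient.mk_symm]
      exact hA.mk_eq_mk ha fun t => hc' _
    have hb1 : Path.Homotopic.Quotient.mk b = .trans (.symm (.mk b')) (.mk b'') := by
      rw [← Path.Homotopic.Quotient.mk_symm, ← Path.Homotopic.Quotient.mk_trans]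
      refine hB.mk_eq_mk hb fun t => ?_
      rw [Path.trans_apply]
      split_ifs
      exacts [hb' _, hb'' _]
    -- The new loop is the inverse of the consecutive loop j, followed by a crossing loop through v
    -- j.castSucc; the product is written in the reversed order.
    have h := S.mul_mem (ih a' b'' c ha' hb'' hc) (S.inv_mem hmem)
    convert h using 1
    change (.mk (a.trans (b.trans c)) : Path.Homotopic.Quotient x₀ x₀) =
      .trans (.symm (.mk (a'.trans (b'.trans c')))) (.mk (a'.trans (b''.trans c)))
    simp only [Path.Homotopic.Quotient.mk_trans, ha1, hb1, Path.Homotopic.Quotient.symm_trans_rev,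
      Path.Homotopic.Quotient.trans_assoc, Path.Homotopic.Quotient.symm_trans_cancel_left]

/-! ### The fundamental group of the thrice-punctured disk -/

theorem JoinedIn.preimage_val {Y : Type*} [TopologicalSpace Y] {s F : Set Y} (hF : F ⊆ s)
    {x y : s} (h : JoinedIn F (x : Y) y) : JoinedIn (Subtype.val ⁻¹' F) x y :=
  ⟨⟨⟨fun t => ⟨h.somePath t, hF (h.somePath_mem t)⟩, by fun_prop⟩, Subtype.ext (by simp),
    Subtype.ext (by simp)⟩, fun t => h.somePath_mem t⟩

/-- The punctures `-2`, `0`, `2`. -/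
def puncture (j : Fin 3) : ℝ := 2 * (j : ℝ) - 2

theorem mem_puncturedDisk_iff {z : ℂ} :
    z ∈ puncturedDisk ↔ ‖z‖ < 4 ∧ ∀ j, z ≠ (puncture j : ℂ) := by
  have h : (2 : ℂ) * (1 + 1) - 2 = 2 := by norm_num
  simp [puncturedDisk, Fin.forall_fin_succ, puncture, h]

/-- The open disk slit along the rays from the punctures away from the point `3εi`. -/
def slitDisk (ε : ℝ) : Set ℂ :=
  {z | ‖z‖ < 4 ∧ (0 < ε * z.im ∨ ∀ j, 3 * (z.re - puncture j) + ε * puncture j * z.im ≠ 0)}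

theorem slitDisk_subset (ε : ℝ) : slitDisk ε ⊆ puncturedDisk := by
  rintro z ⟨h1, h2⟩
  refine mem_puncturedDisk_iff.2 ⟨h1, fun j hj => ?_⟩
  rcases h2 with h2 | h2
  · simp [hj] at h2
  · exact h2 j (by simp [hj])

theorem isOpen_slitDisk (ε : ℝ) : IsOpen (slitDisk ε) := by
  have h : slitDisk ε = {z | ‖z‖ < 4} ∩ ({z | 0 < ε * z.im} ∪
      ⋂ j, {z | 3 * (z.re - puncture j) + ε * puncture j * z.im ≠ 0}) := by
    ext z; simp [slitDisk]
  rw [h]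
  refine (isOpen_lt (by fun_prop) (by fun_prop)).inter
    ((isOpen_lt (by fun_prop) (by fun_prop)).union (isOpen_iInter_of_finite fun j =>
      isOpen_ne_fun (by fun_prop) (by fun_prop)))

theorem base_mem_slitDisk {ε : ℝ} (hε : ε * ε = 1) : ((3 * ε : ℝ) * Complex.I : ℂ) ∈ slitDisk ε := by
  refine ⟨?_, Or.inl ?_⟩
  · have : |ε| = 1 := by
      rw [← abs_mul_abs_self] at hε
      nlinarith [abs_nonneg ε]
    rw [norm_mul, Complex.norm_I, Complex.norm_real, Real.norm_eq_abs, abs_mul, this]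
    norm_num
  · simp; nlinarith

/-- The affine form cutting out each slit vanishes at the centre, so along a segment from the centre
it is merely scaled; the quantity ε · im stays positive once it is positive at the far end. -/
theorem starConvex_slitDisk {ε : ℝ} (hε : ε * ε = 1) :
    StarConvex ℝ ((3 * ε : ℝ) * Complex.I : ℂ) (slitDisk ε) := by
  intro z hz a b ha hb hab
  have hball : Convex ℝ {z : ℂ | ‖z‖ < 4} := by
    have := convex_ball (0 : ℂ) 4
    simpa [Metric.ball] using this
  refine ⟨hball (base_mem_slitDisk hε).1 hz.1 ha hb hab, ?_⟩
  have him : ε * (a • ((3 * ε : ℝ) * Complex.I : ℂ) + b • z).im = 3 * a + b * (ε * z.im) := by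
    simp
    linear_combination (3 * a) * hε
  have hre : (a • ((3 * ε : ℝ) * Complex.I : ℂ) + b • z).re = b * z.re := by simp
  rw [him]
  rcases hz.2 with h | h
  · left
    rcases ha.eq_or_lt with rfl | ha
    · obtain rfl : b = 1 := by linarith
      linarith
    · nlinarith
  · by_cases hb0 : b = 0
    · left; subst hb0; linarith
    · right
      intro j h0
      refine h j ((mul_eq_zero.1 (?_ : b * _ = 0)).resolve_left hb0)
      rw [hre, mul_right_comm, him] at h0
      linear_combination h0 - (3 * puncture j) * hab

/-- The projection of the upper half plane from `-3i`, and of the lower half plane from `3i`, onto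
the real line. -/
noncomputable def slitRatio (z : ℂ) : ℝ := 3 * z.re / (3 + |z.im|)

theorem slitRatio_continuous : Continuous slitRatio := by
  unfold slitRatio
  refine Continuous.div (by fun_prop) (by fun_prop) fun z => by positivity

theorem slitRatio_ofReal (t : ℝ) : slitRatio t = t := by
  simp [slitRatio]

/-- The slits of `slitDisk 1` lie in the closed lower half plane and those of `slitDisk (-1)` in the
closed upper one. There they are exactly the level sets of `slitRatio` at the punctures. -/
theorem slitDisk_inter : slitDisk 1 ∩ slitDisk (-1) =
    {z | ‖z‖ < 4 ∧ ∀ j, slitRatio z ≠ puncture j} := by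
  ext z
  have hpos : 0 < 3 + |z.im| := by positivity
  have key : ∀ j, slitRatio z ≠ puncture j ↔
      3 * (z.re - puncture j) - puncture j * |z.im| ≠ 0 := by
    intro j
    rw [slitRatio, Ne, div_eq_iff hpos.ne', not_iff_not]
    constructor <;> intro h <;> linear_combination h
  simp only [slitDisk, Set.mem_inter_iff, Set.mem_ofPred_eq, key]
  rcases lt_trichotomy z.im 0 with h | h | h
  · rw [abs_of_neg h]
    have h1 : ¬ (0 < 1 * z.im) := by linarith
    have h2 : 0 < -1 * z.im := by linarith
    simp only [h1, h2, false_or, true_or, and_true]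
    have : ∀ j, 3 * (z.re - puncture j) + 1 * puncture j * z.im =
      3 * (z.re - puncture j) - puncture j * -z.im := fun j => by ring
    simp only [this]
    tauto
  · simp [h]
  · rw [abs_of_pos h]
    have h1 : ¬ (0 < -1 * z.im) := by linarith
    have h2 : 0 < 1 * z.im := by linarith
    simp only [h1, h2, false_or, true_or, and_true]
    have : ∀ j, 3 * (z.re - puncture j) + -1 * puncture j * z.im =
      3 * (z.re - puncture j) - puncture j * z.im := fun j => by ring
    simp only [this]
    tauto

theorem puncturedDisk_subset_union : puncturedDisk ⊆ slitDisk 1 ∪ slitDisk (-1) := by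
  intro z hz
  rw [mem_puncturedDisk_iff] at hz
  rcases lt_trichotomy z.im 0 with h | h | h
  · exact Or.inr ⟨hz.1, Or.inl (by linarith)⟩
  · refine Or.inl ⟨hz.1, Or.inr fun j hj => hz.2 j (Complex.ext ?_ (by simpa using h))⟩
    rw [h] at hj
    simp only [Complex.ofReal_re]
    linarith
  · exact Or.inl ⟨hz.1, Or.inl (by linarith)⟩

/-- Points of the real line separated by the punctures. -/
def crossingPoint (j : Fin 4) : ℝ := 2 * (j : ℝ) - 3

theorem norm_crossingPoint_lt (j : Fin 4) : ‖(crossingPoint j : ℂ)‖ < 4 := by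
  rw [Complex.norm_real, Real.norm_eq_abs, abs_lt]
  fin_cases j <;> simp [crossingPoint] <;> norm_num

theorem crossingPoint_ne_puncture (i : Fin 4) (j : Fin 3) : crossingPoint i ≠ puncture j := by
  intro h
  have h1 : (2 * (i : ℤ) - 3 : ℤ) = 2 * (j : ℤ) - 2 := by
    have : (2 * (i : ℝ) - 3) = 2 * (j : ℝ) - 2 := h
    exact_mod_cast this
  omega

theorem crossingPoint_mem_inter (j : Fin 4) :
    (crossingPoint j : ℂ) ∈ slitDisk 1 ∩ slitDisk (-1) := by
  rw [slitDisk_inter]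
  refine ⟨norm_crossingPoint_lt j, fun i => ?_⟩
  rw [slitRatio_ofReal]
  exact crossingPoint_ne_puncture j i

theorem abs_slitRatio_le (z : ℂ) : |slitRatio z| ≤ ‖z‖ := by
  have hpos : 0 < 3 + |z.im| := by positivity
  refine le_trans ?_ (Complex.abs_re_le_norm z)
  rw [slitRatio, abs_div, abs_of_pos hpos, div_le_iff₀ hpos, abs_mul,
    abs_of_pos (show (0 : ℝ) < 3 by norm_num)]
  nlinarith [mul_nonneg (abs_nonneg z.re) (abs_nonneg z.im)]

/-- The segment from z to its projection on the real line keeps `slitRatio` constant. From there a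
real segment reaches the crossing point in the same gap between punctures. -/
theorem joinedIn_slitDisk_inter {z : ℂ} (hz : z ∈ slitDisk 1 ∩ slitDisk (-1)) :
    ∃ j, JoinedIn (slitDisk 1 ∩ slitDisk (-1)) (crossingPoint j : ℂ) z := by
  rw [slitDisk_inter] at *
  have hball : Convex ℝ {z : ℂ | ‖z‖ < 4} := by
    have := convex_ball (0 : ℂ) 4
    simpa [Metric.ball] using this
  have hnorm : ‖(slitRatio z : ℂ)‖ < 4 := by
    rw [Complex.norm_real, Real.norm_eq_abs]
    exact (abs_slitRatio_le z).trans_lt hz.1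
  have h1 : JoinedIn {z | ‖z‖ < 4 ∧ ∀ j, slitRatio z ≠ puncture j} (slitRatio z : ℂ) z := by
    refine JoinedIn.of_segment_subset ?_
    rintro w ⟨a, b, ha, hb, hab, rfl⟩
    refine ⟨hball hnorm hz.1 ha hb hab, fun j => ?_⟩
    have h2 : slitRatio (a • (slitRatio z : ℂ) + b • z) = slitRatio z := by
      have hpos : 0 < 3 + |z.im| := by positivity
      have hpos' : 0 < 3 + b * |z.im| := by positivity
      have hs : slitRatio z * (3 + |z.im|) = 3 * z.re := by
        rw [slitRatio]; field_simp
      generalize slitRatio z = s at *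
      simp only [slitRatio, Complex.add_im, Complex.real_smul, Complex.mul_im, Complex.ofReal_re,
        Complex.ofReal_im, Complex.add_re, Complex.mul_re, mul_zero, zero_mul, add_zero, zero_add,
        sub_zero, abs_mul, abs_of_nonneg hb]
      rw [div_eq_iff hpos'.ne']
      linear_combination 3 * s * hab - b * hs
    rw [h2]
    exact hz.2 j
  obtain ⟨j, hj⟩ : ∃ j : Fin 4, ∀ i, (crossingPoint j < puncture i ↔ slitRatio z < puncture i) := by
    have h0 := hz.2 0
    have h1 := hz.2 1
    have h2 := hz.2 2
    simp only [puncture] at h0 h1 h2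
    norm_num at h0 h1 h2
    rcases lt_or_gt_of_ne h0 with h0 | h0
    · refine ⟨0, fun i => ?_⟩
      fin_cases i <;> simp [crossingPoint, puncture] <;> norm_num <;> linarith
    rcases lt_or_gt_of_ne h1 with h1 | h1
    · refine ⟨1, fun i => ?_⟩
      fin_cases i <;> simp [crossingPoint, puncture] <;> norm_num <;> linarith
    rcases lt_or_gt_of_ne h2 with h2 | h2
    · refine ⟨2, fun i => ?_⟩
      fin_cases i <;> simp [crossingPoint, puncture] <;> norm_num <;> linarith
    · refine ⟨3, fun i => ?_⟩
      fin_cases i <;> simp [crossingPoint, puncture] <;> norm_num <;> linarith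
  refine ⟨j, JoinedIn.trans (JoinedIn.of_segment_subset ?_) h1⟩
  rintro w ⟨a, b, ha, hb, hab, rfl⟩
  refine ⟨hball (norm_crossingPoint_lt j) hnorm ha hb hab, fun i => ?_⟩
  have h2 : a • (crossingPoint j : ℂ) + b • (slitRatio z : ℂ) =
    ((a * crossingPoint j + b * slitRatio z : ℝ) : ℂ) := by simp
  rw [h2, slitRatio_ofReal]
  rcases lt_or_gt_of_ne (crossingPoint_ne_puncture j i) with h3 | h3
  · have h4 := (hj i).1 h3
    have := (convex_Iio (𝕜 := ℝ) (puncture i)) h3 h4 ha hb hab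
    exact ne_of_lt (by simpa using this)
  · have h4 : puncture i < slitRatio z :=
      lt_of_le_of_ne (not_lt.1 fun h => h3.not_gt ((hj i).2 h)) (hz.2 i).symm
    have := (convex_Ioi (𝕜 := ℝ) (puncture i)) h3 h4 ha hb hab
    exact ne_of_gt (by simpa using this)

/-- The base point `3i` of the punctured disk. -/
noncomputable def diskBase : puncturedDisk :=
  ⟨3 * Complex.I, slitDisk_subset 1 (by simpa using base_mem_slitDisk (ε := 1) (by norm_num))⟩

/-- The point of the punctured disk on the real line between two punctures. -/
noncomputable def diskCrossing (j : Fin 4) : puncturedDisk :=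
  ⟨(crossingPoint j : ℂ), slitDisk_subset 1 (crossingPoint_mem_inter j).1⟩

/-- The slit disks, as subsets of the punctured disk. -/
def diskHalf (ε : ℝ) : Set puncturedDisk := Subtype.val ⁻¹' slitDisk ε

theorem isOpen_diskHalf (ε : ℝ) : IsOpen (diskHalf ε) :=
  (isOpen_slitDisk ε).preimage continuous_subtype_val

theorem isSimplyConnected_diskHalf {ε : ℝ} (hε : ε * ε = 1) : IsSimplyConnected (diskHalf ε) := by
  rw [← Topology.IsEmbedding.subtypeVal.isSimplyConnected_image, diskHalf,
    Subtype.image_preimage_coe, Set.inter_eq_right.2 (slitDisk_subset ε)]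
  have := (starConvex_slitDisk hε).contractibleSpace ⟨_, base_mem_slitDisk hε⟩
  change SimplyConnectedSpace (slitDisk ε)
  infer_instance

theorem mem_diskHalf_or (x : puncturedDisk) : x ∈ diskHalf 1 ∨ x ∈ diskHalf (-1) :=
  puncturedDisk_subset_union x.2

theorem diskBase_mem : diskBase ∈ diskHalf 1 := by
  have := base_mem_slitDisk (ε := 1) (by norm_num)
  simpa [diskHalf, diskBase] using this

theorem diskCrossing_mem (j : Fin 4) : diskCrossing j ∈ diskHalf 1 ∩ diskHalf (-1) :=
  crossingPoint_mem_inter j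

/-- A loop at the base point is a crossing loop of the puncture `j` if it passes the real line
downwards on the left of the puncture and upwards on the right of it. -/
def IsCrossingLoop (j : Fin 3) (γ : FundamentalGroup puncturedDisk diskBase) : Prop :=
  ∃ (a : Path diskBase (diskCrossing j.castSucc))
    (b : Path (diskCrossing j.castSucc) (diskCrossing j.succ))
    (c : Path (diskCrossing j.succ) diskBase), (∀ t, a t ∈ diskHalf 1) ∧
    (∀ t, b t ∈ diskHalf (-1)) ∧ (∀ t, c t ∈ diskHalf 1) ∧
    γ = FundamentalGroup.fromPath (.mk (a.trans (b.trans c)))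

theorem exists_isCrossingLoop (j : Fin 3) : ∃ γ, IsCrossingLoop j γ := by
  have hA := isSimplyConnected_diskHalf (ε := 1) (by norm_num)
  have hB := isSimplyConnected_diskHalf (ε := -1) (by norm_num)
  obtain ⟨a, ha⟩ := hA.exists_path diskBase_mem (diskCrossing_mem j.castSucc).1
  obtain ⟨b, hb⟩ := hB.exists_path (diskCrossing_mem j.castSucc).2 (diskCrossing_mem j.succ).2
  obtain ⟨c, hc⟩ := hA.exists_path (diskCrossing_mem j.succ).1 diskBase_mem
  exact ⟨_, a, b, c, ha, hb, hc, rfl⟩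

/-- The locally constant word on the line minus the punctures that is multiplied on the left by the
generator `j` when the puncture `j` is passed from left to right. -/
noncomputable def crossingWord (t : ℝ) : FreeGroup (Fin 3) :=
  (if puncture 2 < t then FreeGroup.of 2 else 1) * (if puncture 1 < t then FreeGroup.of 1 else 1) *
    (if puncture 0 < t then FreeGroup.of 0 else 1)

theorem eventually_crossingWord_eq {t : ℝ} (ht : ∀ j, t ≠ puncture j) :
    ∀ᶠ s in nhds t, crossingWord s = crossingWord t := by
  have key : ∀ j, ∀ᶠ s in nhds t, (puncture j < s ↔ puncture j < t) := by
    intro j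
    rcases lt_or_gt_of_ne (ht j) with h | h
    · filter_upwards [eventually_lt_nhds h] with s hs
      exact iff_of_false hs.not_gt h.not_gt
    · filter_upwards [eventually_gt_nhds h] with s hs
      exact iff_of_true hs h
  filter_upwards [key 0, key 1, key 2] with s h0 h1 h2
  simp only [crossingWord, h0, h1, h2]

theorem crossingWord_mul_inv (j : Fin 3) :
    crossingWord (crossingPoint j.succ) * (crossingWord (crossingPoint j.castSucc))⁻¹ =
      FreeGroup.of j := by
  fin_cases j <;> norm_num [crossingWord, crossingPoint, puncture]; rfl

/-- The fundamental group of the thrice-punctured disk is free on three crossing loops. -/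
theorem exists_freeGroup_mulEquiv :
    ∃ Ψ : FreeGroup (Fin 3) ≃* FundamentalGroup puncturedDisk diskBase,
      ∀ j, IsCrossingLoop j (Ψ (FreeGroup.of j)) := by
  choose ℓ hℓ using exists_isCrossingLoop
  -- The gluing function is `crossingWord` of the projection to the real line, locally constant off
  -- the slits; crossing gap by gap changes it by one generator.
  have hinj : Function.Injective (FreeGroup.lift ℓ) := by
    refine injective_lift_of_crossing_loops (isOpen_diskHalf 1) (isOpen_diskHalf (-1))
      mem_diskHalf_or (g := fun z => crossingWord (slitRatio z)) (fun x hx => ?_) ℓ (fun j => ?_)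
    · have hx' : (x : ℂ) ∈ slitDisk 1 ∩ slitDisk (-1) := hx
      rw [slitDisk_inter] at hx'
      exact (slitRatio_continuous.comp continuous_subtype_val).continuousAt.eventually
        (eventually_crossingWord_eq hx'.2)
    · obtain ⟨a, b, c, ha, hb, hc, h⟩ := hℓ j
      refine ⟨_, _, a, b, c, ha, hb, hc, ?_, h⟩
      simp only [diskCrossing, slitRatio_ofReal]
      exact crossingWord_mul_inv j
  have hsurj : Function.Surjective (FreeGroup.lift ℓ) := by
    rw [← MonoidHom.range_eq_top]
    refine subgroup_eq_top_of_consecutive_loops_mem (isOpen_diskHalf 1) (isOpen_diskHalf (-1))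
      mem_diskHalf_or (isSimplyConnected_diskHalf (by norm_num))
      (isSimplyConnected_diskHalf (by norm_num)) diskBase_mem diskCrossing diskCrossing_mem
      (fun x hx => ?_) _ (fun j => ?_)
    · obtain ⟨j, hj⟩ := joinedIn_slitDisk_inter (z := x) hx
      exact ⟨j, JoinedIn.preimage_val (Set.inter_subset_left.trans (slitDisk_subset 1)) hj⟩
    · obtain ⟨a, b, c, ha, hb, hc, h⟩ := hℓ j
      exact ⟨a, b, c, ha, hb, hc, h ▸ ⟨FreeGroup.of j, FreeGroup.lift_apply_of⟩⟩
  refine ⟨MulEquiv.ofBijective _ ⟨hinj, hsurj⟩, fun j => ?_⟩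
  have h : FreeGroup.lift ℓ (FreeGroup.of j) = ℓ j := FreeGroup.lift_apply_of
  exact h ▸ hℓ j

theorem diskBase_sub_ne_zero (j : Fin 3) : (diskBase : ℂ) - puncture j ≠ 0 :=
  sub_ne_zero.2 ((mem_puncturedDisk_iff.1 diskBase.2).2 j)

/-- The coordinate around a puncture, normalized to be `1` at the base point. -/
noncomputable def punctureCoord (j : Fin 3) : C(puncturedDisk, {z : ℂ // z ≠ 0}) where
  toFun z := ⟨((z : ℂ) - puncture j) / ((diskBase : ℂ) - puncture j),
    div_ne_zero (sub_ne_zero.2 ((mem_puncturedDisk_iff.1 z.2).2 j)) (diskBase_sub_ne_zero j)⟩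
  continuous_toFun := by fun_prop

theorem punctureCoord_diskBase (j : Fin 3) : (punctureCoord j diskBase : ℂ) = 1 :=
  div_self (diskBase_sub_ne_zero j)

/-- The winding number around a puncture, times `2πi`. -/
noncomputable def punctureWinding (j : Fin 3) :
    FundamentalGroup puncturedDisk diskBase →* Multiplicative ℂ :=
  windingHom (punctureCoord j) (punctureCoord_diskBase j)

/-- The quotient is real exactly when z lies on the line through the puncture and the centre 3εi. On
that line the slit disk contains only points on the side of the centre, where the quotient is
positive. Hence the principal logarithm is continuous there. -/
theorem mem_slitPlane_of_mem_slitDisk {ε : ℝ} (hε : ε * ε = 1) {z : ℂ} (hz : z ∈ slitDisk ε)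
    (j : Fin 3) : (z - puncture j) / ((3 * ε : ℝ) * Complex.I - puncture j) ∈ Complex.slitPlane := by
  have hb : ((3 * ε : ℝ) * Complex.I - puncture j : ℂ) ≠ 0 :=
    sub_ne_zero.2 ((mem_puncturedDisk_iff.1 (slitDisk_subset ε (base_mem_slitDisk hε))).2 j)
  have hpos := Complex.normSq_pos.2 hb
  rw [Complex.mem_slitPlane_iff, Complex.div_re, Complex.div_im, ← add_div, ← sub_div,
    div_pos_iff_of_pos_right hpos, div_ne_zero_iff, and_iff_left hpos.ne']
  simp only [Complex.sub_re, Complex.sub_im, Complex.mul_re, Complex.mul_im, Complex.ofReal_re,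
    Complex.ofReal_im, Complex.I_re, Complex.I_im]
  have hε0 : ε ≠ 0 := by rintro rfl; simp at hε
  by_cases h : 3 * (z.re - puncture j) + ε * puncture j * z.im = 0
  · left
    have him : 0 < ε * z.im := hz.2.resolve_right fun h' => h' j h
    have h2 : -3 * puncture j * (z.re - puncture j) = puncture j * puncture j * (ε * z.im) := by
      linear_combination (-puncture j) * h
    linarith [mul_nonneg (mul_self_nonneg (puncture j)) him.le]
  · right
    intro h0
    apply h
    linear_combination (-ε) * h0 + (-3 * (z.re - puncture j)) * hε

theorem Complex.log_neg_of_im_ne_zero {w : ℂ} (hw : w.im ≠ 0) :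
    log (-w) = log w - (if 0 < w.im then 1 else -1) * Real.pi * I := by
  rw [log, log, norm_neg]
  split_ifs with h
  · rw [arg_neg_eq_arg_sub_pi_of_im_pos h]
    push_cast; ring
  · rw [arg_neg_eq_arg_add_pi_of_im_neg (lt_of_le_of_ne (not_lt.1 h) hw)]
    push_cast; ring

/-- Compares the branches of the logarithm normalized at 3i and at −3i: for u > 0 they agree, for u
< 0 they differ by the sign of πi. -/
theorem Complex.log_ofReal_div_add_log {u : ℝ} (hu : u ≠ 0) {w : ℂ} (hw : w.im ≠ 0) :
    log (u / w) + log w = if 0 < u then (Real.log u : ℂ) else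
      Real.log (-u) + (if 0 < w.im then 1 else -1) * Real.pi * I := by
  have hw0 : w ≠ 0 := by rintro rfl; simp at hw
  have harg : ∀ {v : ℂ}, v.im ≠ 0 → v.arg ≠ Real.pi := fun hv h => hv (arg_eq_pi_iff.1 h).2
  by_cases h : 0 < u
  · rw [if_pos h, div_eq_mul_inv, log_ofReal_mul h (inv_ne_zero hw0), log_inv _ (harg hw)]
    ring
  · have hu' : 0 < -u := by
      have := lt_of_le_of_ne (not_lt.1 h) hu
      linarith
    have h1 : (u : ℂ) / w = ((-u : ℝ) : ℂ) * (-w)⁻¹ := by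
      rw [inv_neg, div_eq_mul_inv]; push_cast; ring
    rw [if_neg h, h1, log_ofReal_mul hu' (inv_ne_zero (neg_ne_zero.2 hw0)),
      log_inv _ (harg (by simpa using hw)), log_neg_of_im_ne_zero hw]
    ring

/-- The winding numbers of crossing loops. -/
theorem punctureWinding_of_isCrossingLoop {i : Fin 3}
    {γ : FundamentalGroup puncturedDisk diskBase} (h : IsCrossingLoop i γ) (j : Fin 3) :
    punctureWinding j γ = Multiplicative.ofAdd (if i = j then 2 * Real.pi * Complex.I else 0) := by
  obtain ⟨a, b, c, ha, hb, hc, rfl⟩ := h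
  let W : ℝ → ℂ := fun ε => (3 * ε : ℝ) * Complex.I - puncture j
  let L : ℝ → puncturedDisk → ℂ := fun ε z =>
    Complex.log (((z : ℂ) - puncture j) / W ε) + Complex.log (W ε)
  have hW : ∀ {ε : ℝ}, ε * ε = 1 → W ε ≠ 0 := fun hε =>
    sub_ne_zero.2 ((mem_puncturedDisk_iff.1 (slitDisk_subset _ (base_mem_slitDisk hε))).2 j)
  have hL : ∀ {ε : ℝ}, ε * ε = 1 → ContinuousOn (L ε) (diskHalf ε) := by
    intro ε hε
    have h : Continuous fun z : puncturedDisk => ((z : ℂ) - puncture j) / W ε := by fun_prop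
    exact (h.continuousOn.clog fun z hz => mem_slitPlane_of_mem_slitDisk hε hz j).add
      continuousOn_const
  have hexp : ∀ {ε : ℝ}, ε * ε = 1 → ∀ x ∈ diskHalf ε,
      Complex.exp (L ε x) = ((diskBase : ℂ) - puncture j) * punctureCoord j x := by
    intro ε hε x hx
    have h1 : (punctureCoord j x : ℂ) =
      ((x : ℂ) - puncture j) / ((diskBase : ℂ) - puncture j) := rfl
    rw [Complex.exp_add, Complex.exp_log (Complex.slitPlane_ne_zero
      (mem_slitPlane_of_mem_slitDisk hε hx j)), Complex.exp_log (hW hε), h1,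
      div_mul_cancel₀ _ (hW hε), mul_div_cancel₀ _ (diskBase_sub_ne_zero j)]
  -- The two branches agree to the right of the puncture j and differ by 2πi to its left, so only a
  -- loop crossing on both sides of j sees a change.
  have hdiff : ∀ k, L 1 (diskCrossing k) - L (-1) (diskCrossing k) =
      if puncture j < crossingPoint k then 0 else 2 * Real.pi * Complex.I := by
    intro k
    have h1 : ∀ ε : ℝ, L ε (diskCrossing k) =
        Complex.log (((crossingPoint k - puncture j : ℝ) : ℂ) / W ε) + Complex.log (W ε) := by
      intro ε
      simp [L, diskCrossing]
    have him : ∀ ε, (W ε).im = 3 * ε := fun ε => by simp [W]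
    have hu := sub_ne_zero.2 (crossingPoint_ne_puncture k j)
    rw [h1, h1, Complex.log_ofReal_div_add_log hu (by rw [him]; norm_num),
      Complex.log_ofReal_div_add_log hu (by rw [him]; norm_num), him, him]
    simp only [sub_pos]
    norm_num
    split_ifs
    · simp
    · ring
  rw [punctureWinding, windingHom_crossing (punctureCoord j) (punctureCoord_diskBase j)
    (hL (by norm_num)) (hL (by norm_num)) (hexp (by norm_num)) (hexp (by norm_num)) a b c ha hb hc,
    hdiff, hdiff]
  congr 1
  have h1 : puncture j < crossingPoint i.castSucc ↔ j < i := by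
    rw [← sub_pos]
    have : crossingPoint i.castSucc - puncture j = ((2 * (i : ℤ) - 2 * (j : ℤ) - 1 : ℤ) : ℝ) := by
      simp [crossingPoint, puncture]; ring
    rw [this, Int.cast_pos, Fin.lt_def]
    omega
  have h2 : puncture j < crossingPoint i.succ ↔ j ≤ i := by
    rw [← sub_pos]
    have : crossingPoint i.succ - puncture j = ((2 * (i : ℤ) - 2 * (j : ℤ) + 1 : ℤ) : ℝ) := by
      simp [crossingPoint, puncture]; ring
    rw [this, Int.cast_pos, Fin.le_def]
    omega
  simp only [h1, h2]
  rcases lt_trichotomy i j with h | h | h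
  · simp [h.not_gt, h.not_ge, h.ne]
  · simp [h]
  · simp [h, h.le, h.ne']

/-! ### The action of the braid on winding numbers -/

theorem twistMap_injective (c : ℂ) (a : ℝ) : Function.Injective (twistMap c a) :=
  Function.LeftInverse.injective (g := twistMap c (-a)) (twistMap_neg_twistMap c a)

theorem twistMap_zero (c z : ℂ) : twistMap c 0 z = z := by
  simp [twistMap]

theorem twistMap_diskBase {c : ℂ} (hc : c = -1 ∨ c = 1) (a : ℝ) :
    twistMap c a diskBase = diskBase := by
  refine twistMap_of_le ?_
  have h : (3 : ℝ) ≤ ‖(diskBase : ℂ) - c‖ := by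
    refine le_trans ?_ (Complex.abs_im_le_norm _)
    rcases hc with rfl | rfl <;> simp [diskBase]
  linarith

/-- A half twist permutes the winding numbers around the punctures. -/
theorem punctureWinding_mapOfEq_of_twistMap {c : ℂ} (hc : c = -1 ∨ c = 1) {a : ℝ}
    (h : C(puncturedDisk, puncturedDisk)) (hh : ∀ z, (h z : ℂ) = twistMap c a z)
    (hb : h diskBase = diskBase) {i j : Fin 3} (hij : twistMap c a (puncture i) = puncture j)
    (γ : FundamentalGroup puncturedDisk diskBase) :
    punctureWinding j (FundamentalGroup.mapOfEq h hb γ) = punctureWinding i γ := by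
  have hval : ((punctureCoord j).comp h diskBase : ℂ) = 1 := by
    rw [ContinuousMap.comp_apply, hb, punctureCoord_diskBase]
  have hne : ∀ (s : ℝ) (z : puncturedDisk), twistMap c s z - twistMap c s (puncture i) ≠ 0 :=
    fun s z => sub_ne_zero.2 ((twistMap_injective c s).ne ((mem_puncturedDisk_iff.1 z.2).2 i))
  have hne' : ∀ s : ℝ, (diskBase : ℂ) - twistMap c s (puncture i) ≠ 0 := fun s => by
    have := hne s diskBase
    rwa [twistMap_diskBase hc] at this
  -- The twist is performed gradually, by angle s · a, and positions are measured from the moving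
  -- image of puncture i. Injectivity of each stage keeps the coordinate nonzero; the base point
  -- lies outside the support.
  let H : (punctureCoord i).HomotopyRel ((punctureCoord j).comp h) {diskBase} :=
    { toFun := fun p => ⟨(twistMap c (p.1 * a) p.2 - twistMap c (p.1 * a) (puncture i)) /
        ((diskBase : ℂ) - twistMap c (p.1 * a) (puncture i)), div_ne_zero (hne _ _) (hne' _)⟩
      continuous_toFun := by
        have h1 : Continuous fun p : unitInterval × puncturedDisk =>
            twistMap c (p.1 * a) p.2 := by
          unfold twistMap twistProfile
          fun_prop
        have h2 : Continuous fun p : unitInterval × puncturedDisk =>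
            twistMap c (p.1 * a) (puncture i) := by
          unfold twistMap twistProfile
          fun_prop
        exact ((h1.sub h2).div (continuous_const.sub h2) fun p => hne' _).subtype_mk _
      map_zero_left := fun z => Subtype.ext (by simp [twistMap_zero, punctureCoord])
      map_one_left := fun z => Subtype.ext (by simp [hij, hh, punctureCoord])
      prop' := by
        rintro s _ rfl
        refine Subtype.ext ?_
        change (twistMap c (s * a) diskBase - _) / _ = (punctureCoord i diskBase : ℂ)
        rw [twistMap_diskBase hc, punctureCoord_diskBase, div_self (hne' _)] }
  rw [punctureWinding, windingHom_mapOfEq _ _ _ _ hval, punctureWinding,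
    windingHom_eq_of_homotopy (punctureCoord_diskBase i) hval H]

theorem coe_sigma1_apply (z : puncturedDisk) : (sigma1 z : ℂ) = twistMap (-1) Real.pi z := rfl

theorem coe_sigma2_inv_apply (z : puncturedDisk) :
    (sigma2⁻¹ z : ℂ) = twistMap 1 (-Real.pi) z := rfl

theorem sigma1_diskBase : sigma1 diskBase = diskBase :=
  Subtype.ext (by rw [coe_sigma1_apply, twistMap_diskBase (Or.inl rfl)])

theorem sigma2_inv_diskBase : sigma2⁻¹ diskBase = diskBase :=
  Subtype.ext (by rw [coe_sigma2_inv_apply, twistMap_diskBase (Or.inr rfl)])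

theorem braidBeta_diskBase : braidBeta diskBase = diskBase := by
  rw [braidBeta, Homeomorph.mul_apply, sigma2_inv_diskBase, sigma1_diskBase]

/-- The source of the prime 3: the two transpositions of punctures compose to the 3-cycle −2 → 0 → 2
→ −2. -/
theorem exists_twistMap_puncture (j : Fin 3) :
    ∃ i, twistMap 1 (-Real.pi) (puncture j) = puncture i ∧
      twistMap (-1) Real.pi (puncture i) = puncture (j + 1) := by
  have hp0 : (puncture 0 : ℂ) = -2 := by norm_num [puncture]
  have hp1 : (puncture 1 : ℂ) = 0 := by norm_num [puncture]
  have hp2 : (puncture 2 : ℂ) = 2 := by norm_num [puncture]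
  have hj : j = 0 ∨ j = 1 ∨ j = 2 := by omega
  rcases hj with rfl | rfl | rfl
  · refine ⟨0, ?_, ?_⟩
    · rw [hp0, twistMap_of_le (by norm_num)]
    · rw [hp0, zero_add, hp1, twistMap_pi_of_le (Or.inl rfl) (by norm_num)]
      norm_num
  · refine ⟨2, ?_, ?_⟩
    · rw [hp1, hp2, twistMap_pi_of_le (Or.inr rfl) (by norm_num)]
      norm_num
    · rw [show (1 + 1 : Fin 3) = 2 from rfl, hp2, twistMap_of_le (by norm_num)]
  · refine ⟨1, ?_, ?_⟩
    · rw [hp1, hp2, twistMap_pi_of_le (Or.inr rfl) (by norm_num)]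
      norm_num
    · rw [show (2 + 1 : Fin 3) = 0 from rfl, hp0, hp1,
        twistMap_pi_of_le (Or.inl rfl) (by norm_num)]
      norm_num

/-- The braid permutes the winding numbers around the punctures cyclically. -/
theorem punctureWinding_braidBeta (j : Fin 3)
    (γ : FundamentalGroup puncturedDisk diskBase) :
    punctureWinding (j + 1) (FundamentalGroup.mapOfEq (braidBeta : C(puncturedDisk, puncturedDisk))
      braidBeta_diskBase γ) = punctureWinding j γ := by
  obtain ⟨i, h2, h1⟩ := exists_twistMap_puncture j
  let s1 : C(puncturedDisk, puncturedDisk) := sigma1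
  let s2 : C(puncturedDisk, puncturedDisk) := (sigma2⁻¹ : puncturedDisk ≃ₜ puncturedDisk)
  have hval : ((punctureCoord (j + 1)).comp s1 diskBase : ℂ) = 1 := by
    have h : s1 diskBase = diskBase := sigma1_diskBase
    rw [ContinuousMap.comp_apply, h, punctureCoord_diskBase]
  have hb : (sigma1 (sigma2⁻¹ diskBase)) = diskBase := braidBeta_diskBase
  have hval2 : (((punctureCoord (j + 1)).comp s1).comp s2 diskBase : ℂ) = 1 := by
    change (punctureCoord (j + 1) (sigma1 (sigma2⁻¹ diskBase)) : ℂ) = 1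
    rw [hb, punctureCoord_diskBase]
  have key : ∀ δ, windingHom ((punctureCoord (j + 1)).comp s1) hval δ = punctureWinding i δ := by
    intro δ
    rw [← punctureWinding_mapOfEq_of_twistMap (Or.inl rfl) s1 coe_sigma1_apply sigma1_diskBase h1,
      punctureWinding, windingHom_mapOfEq]
  calc punctureWinding (j + 1) (FundamentalGroup.mapOfEq _ braidBeta_diskBase γ)
      = windingHom (((punctureCoord (j + 1)).comp s1).comp s2) hval2 γ :=
        windingHom_mapOfEq (punctureCoord (j + 1)) (braidBeta : C(puncturedDisk, puncturedDisk))
          braidBeta_diskBase _ hval2 γ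
    _ = windingHom ((punctureCoord (j + 1)).comp s1) hval
          (FundamentalGroup.mapOfEq s2 sigma2_inv_diskBase γ) :=
        (windingHom_mapOfEq _ s2 sigma2_inv_diskBase hval hval2 γ).symm
    _ = punctureWinding i (FundamentalGroup.mapOfEq s2 sigma2_inv_diskBase γ) := key _
    _ = punctureWinding j γ :=
        punctureWinding_mapOfEq_of_twistMap (Or.inr rfl) s2 coe_sigma2_inv_apply
          sigma2_inv_diskBase h2 γ

/-! ### Semidirect products with the infinite cyclic group -/

theorem map_zpow_apply_of_map_apply {N G : Type*} [Group N] [Group G] {α : MulAut N}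
    {c : MulAut G} {i : N →* G} (h : ∀ f, i (α f) = c (i f)) (n : ℤ) :
    ∀ f, i ((α ^ n) f) = (c ^ n) (i f) := by
  induction n with
  | zero => simp
  | succ n ih =>
    intro f
    rw [zpow_add_one, zpow_add_one, MulAut.mul_apply, MulAut.mul_apply, ih, h]
  | pred n ih =>
    intro f
    have h' : i (α⁻¹ f) = c⁻¹ (i f) := by
      rw [← MulAut.apply_inv_self _ α f]
      simp only [h]
      simp
    rw [zpow_sub_one, zpow_sub_one, MulAut.mul_apply, MulAut.mul_apply, ih, h']

/-- Recognition of a semidirect product with `ℤ`. -/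
theorem nonempty_semidirectProduct_mulEquiv {N G : Type*} [Group N] [Group G] {α : MulAut N}
    {i : N →* G} (hi : Function.Injective i) {t : G} (h : ∀ f, i (α f) = t * i f * t⁻¹)
    {deg : G →* Multiplicative ℤ} (ht : deg t = Multiplicative.ofAdd 1)
    (hdeg : ∀ g, deg g = 1 ↔ g ∈ i.range) :
    Nonempty ((N ⋊[zpowersHom (MulAut N) α] Multiplicative ℤ) ≃* G) := by
  have hdegi : ∀ f, deg (i f) = 1 := fun f => (hdeg _).2 ⟨f, rfl⟩
  have hdegt : ∀ n : Multiplicative ℤ, deg (zpowersHom G t n) = n := by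
    intro n
    rw [zpowersHom_apply, map_zpow, ht, ← ofAdd_zsmul, smul_eq_mul, mul_one, ofAdd_toAdd]
  let F : (N ⋊[zpowersHom (MulAut N) α] Multiplicative ℤ) →* G :=
    SemidirectProduct.lift i (zpowersHom G t) fun n => by
      ext f
      have := map_zpow_apply_of_map_apply (c := MulAut.conj t) h n.toAdd f
      rw [← map_zpow] at this
      exact this
  have hF : ∀ x, F x = i x.left * zpowersHom G t x.right := fun x => rfl
  refine ⟨MulEquiv.ofBijective F ⟨?_, fun g => ?_⟩⟩
  · rw [injective_iff_map_eq_one]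
    intro x hx
    have h1 : x.right = 1 := by
      have := congr_arg deg hx
      rwa [hF, map_mul, hdegi, one_mul, hdegt, map_one] at this
    rw [hF, h1, map_one, mul_one] at hx
    exact SemidirectProduct.ext (hi (hx.trans (map_one i).symm)) h1
  · obtain ⟨f, hf⟩ := (hdeg (g * (zpowersHom G t (deg g))⁻¹)).1 (by
      rw [map_mul, map_inv, hdegt, mul_inv_cancel])
    refine ⟨⟨f, deg g⟩, ?_⟩
    rw [hF, hf, inv_mul_cancel_right]

/-! ### The fundamental group of a mapping torus -/

namespace MappingTorus

variable {X : Type*} [TopologicalSpace X] (ψ : X ≃ₜ X)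

/-- The covering of the mapping torus by the infinite cylinder. -/
def proj (p : X × ℝ) : MappingTorus ψ := Quotient.mk (mappingTorusSetoid ψ) p

/-- The deck transformations of the infinite cylinder over the mapping torus. -/
abbrev deckAction : MulAction (Multiplicative ℤ) (X × ℝ) where
  smul n p := ((ψ ^ (-n.toAdd)) p.1, p.2 + n.toAdd)
  one_smul p := by
    change ((ψ ^ (-(0 : ℤ))) p.1, p.2 + ((0 : ℤ) : ℝ)) = p
    simp
  mul_smul m n p := by
    change ((ψ ^ (-(m.toAdd + n.toAdd))) p.1, p.2 + ((m.toAdd + n.toAdd : ℤ) : ℝ)) =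
      ((ψ ^ (-m.toAdd)) ((ψ ^ (-n.toAdd)) p.1), p.2 + n.toAdd + m.toAdd)
    rw [neg_add, zpow_add, Homeomorph.mul_apply]
    push_cast
    ring_nf

theorem proj_eq_proj {p p' : X × ℝ} :
    proj ψ p = proj ψ p' ↔ ∃ n : ℤ, p' = ((ψ ^ n) p.1, p.2 - n) :=
  Quotient.eq

theorem isQuotientCoveringMap_proj :
    letI := deckAction ψ
    IsQuotientCoveringMap (proj ψ) (Multiplicative ℤ) := by
  let _ := deckAction ψ
  have hsmul : ∀ (n : Multiplicative ℤ) (p : X × ℝ),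
    n • p = ((ψ ^ (-n.toAdd)) p.1, p.2 + n.toAdd) := fun n p => rfl
  refine
    { toIsQuotientMap := isQuotientMap_quot_mk
      continuous_const_smul := fun n => ?_
      apply_eq_iff_mem_orbit := ?_
      -- A nontrivial deck transformation shifts the real coordinate by at least 1, the width of
      -- this slab.
      disjoint := fun p => ⟨Set.univ ×ˢ Metric.ball p.2 (1 / 2), ?_, ?_⟩ }
  · have := (ψ ^ (-n.toAdd)).continuous
    change Continuous fun p : X × ℝ => ((ψ ^ (-n.toAdd)) p.1, p.2 + n.toAdd)
    fun_prop
  · intro p p'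
    rw [eq_comm, proj_eq_proj]
    constructor
    · rintro ⟨n, rfl⟩
      exact ⟨Multiplicative.ofAdd (-n), by simp [hsmul, sub_eq_add_neg]⟩
    · rintro ⟨n, rfl⟩
      exact ⟨-n.toAdd, by simp [hsmul]⟩
  · exact prod_mem_nhds Filter.univ_mem (Metric.ball_mem_nhds _ (by norm_num))
  · rintro n ⟨_, ⟨p', hp', rfl⟩, h⟩
    have h1 := hp'.2
    have h2 := h.2
    simp only [hsmul, Metric.mem_ball, Real.dist_eq, abs_lt] at h1 h2
    have h3 : ((n.toAdd : ℤ) : ℝ) < 1 := by linarith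
    have h4 : (-1 : ℝ) < ((n.toAdd : ℤ) : ℝ) := by linarith
    have h5 : n.toAdd < 1 := by exact_mod_cast h3
    have h6 : -1 < n.toAdd := by exact_mod_cast h4
    have h7 : n.toAdd = 0 := by omega
    exact Multiplicative.toAdd.injective h7

theorem isCoveringMap_proj : IsCoveringMap (proj ψ) :=
  letI := deckAction ψ
  (isQuotientCoveringMap_proj ψ).isCoveringMap

/-- The inclusion of the fibre in the mapping torus. -/
def fiber : C(X, MappingTorus ψ) where
  toFun x := proj ψ (x, 0)
  continuous_toFun := (isCoveringMap_proj ψ).continuous.comp (by fun_prop)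

theorem proj_one (x : X) : proj ψ (x, 1) = fiber ψ (ψ x) :=
  (proj_eq_proj ψ).2 ⟨1, by simp⟩

variable {ψ} {x₀ : X} (h : ψ x₀ = x₀)

/-- The path in the infinite cylinder above the loop traced by a fixed point. -/
def unitSegment (x : X) : Path (x, (0 : ℝ)) (x, 1) where
  toFun s := (x, s)
  continuous_toFun := by fun_prop
  source' := by simp
  target' := by simp

/-- The loop in the mapping torus that is traced by a fixed point. -/
def fixedLoop : Path (fiber ψ x₀) (fiber ψ x₀) :=
  ((unitSegment x₀).map (isCoveringMap_proj ψ).continuous).cast rfl (by rw [proj_one, h])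

theorem monodromy_fixedLoop :
    (isCoveringMap_proj ψ).monodromy (.mk (fixedLoop h)) ⟨(x₀, 0), rfl⟩ =
      ⟨(x₀, 1), by rw [Set.mem_preimage, proj_one, h]; rfl⟩ :=
  (isCoveringMap_proj ψ).monodromy_mk_of_lift _ (unitSegment x₀) (fun _ => rfl) rfl _

/-- The homomorphism of the fundamental group of the mapping torus onto `ℤ` that is trivial on the
fibre. -/
noncomputable def degree (x₀ : X) :
    FundamentalGroup (MappingTorus ψ) (fiber ψ x₀) →* Multiplicative ℤ :=
  letI := deckAction ψ
  (MulEquiv.symm (MulOpposite.opMulEquiv (M := Multiplicative ℤ))).toMonoidHom.comp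
    ((isQuotientCoveringMap_proj ψ).fundamentalGroupToMulOpposite
      (x := fiber ψ x₀) ⟨(x₀, 0), rfl⟩)

theorem degree_fixedLoop :
    degree x₀ (FundamentalGroup.fromPath (.mk (fixedLoop h))) = Multiplicative.ofAdd 1 := by
  let _ := deckAction ψ
  have h1 := ((isQuotientCoveringMap_proj ψ).fundamentalGroupToMulOpposite_apply_eq_Iff
    (x := fiber ψ x₀) (e := ⟨(x₀, 0), rfl⟩) (γ := FundamentalGroup.fromPath (.mk (fixedLoop h)))
    (g := MulOpposite.op (Multiplicative.ofAdd 1))).2 (by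
      have h2 := congr_arg Subtype.val (monodromy_fixedLoop h)
      refine Eq.trans ?_ h2.symm
      have h3 : (ψ ^ (-1 : ℤ)) x₀ = x₀ := by
        rw [zpow_neg_one]
        exact ψ.symm_apply_eq.2 h.symm
      change ((ψ ^ (-1 : ℤ)) x₀, (0 : ℝ) + ((1 : ℤ) : ℝ)) = (x₀, 1)
      rw [h3]
      simp)
  exact congr_arg MulOpposite.unop h1

/-- The inclusion of the fibre in the infinite cylinder. -/
def cylinderInclusion : C(X, X × ℝ) := ⟨fun x => (x, 0), by fun_prop⟩

theorem map_fiber (γ : FundamentalGroup X x₀) :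
    FundamentalGroup.map (fiber ψ) x₀ γ =
      Path.Homotopic.Quotient.map (Path.Homotopic.Quotient.map γ cylinderInclusion)
        ⟨proj ψ, (isCoveringMap_proj ψ).continuous⟩ := by
  induction γ using Path.Homotopic.Quotient.ind with | mk γ => rfl

/-- The fibre inclusion factors through the cylinder: the first factor is split by the projection to
X, and the second is a covering, hence injective on homotopy classes. -/
theorem map_fiber_injective : Function.Injective (FundamentalGroup.map (fiber ψ) x₀) := by
  intro γ γ' hγ
  rw [map_fiber, map_fiber] at hγ
  have h1 := (isCoveringMap_proj ψ).injective_path_homotopic_map _ _ hγ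
  have h2 : ∀ δ : FundamentalGroup X x₀, Path.Homotopic.projLeft
      (Path.Homotopic.Quotient.map δ cylinderInclusion) = δ := by
    intro δ
    induction δ using Path.Homotopic.Quotient.ind with | mk δ => rfl
  rw [← h2 γ, ← h2 γ', h1]

/-- The kernel of the deck homomorphism is the image of the fundamental group of the cylinder, and
the ℝ-component of a loop there is homotopically trivial. -/
theorem degree_eq_one_iff (γ : FundamentalGroup (MappingTorus ψ) (fiber ψ x₀)) :
    degree x₀ γ = 1 ↔ γ ∈ (FundamentalGroup.map (fiber ψ) x₀).range := by
  let _ := deckAction ψ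
  let e : proj ψ ⁻¹' {fiber ψ x₀} := ⟨(x₀, 0), rfl⟩
  have h1 : degree x₀ γ = 1 ↔
      γ ∈ ((isQuotientCoveringMap_proj ψ).fundamentalGroupToMulOpposite e).ker := by
    rw [MonoidHom.mem_ker]
    exact (MulEquiv.symm (MulOpposite.opMulEquiv (M := Multiplicative ℤ))).map_eq_one_iff
  rw [h1, IsQuotientCoveringMap.ker_fundamentalGroupToMulOpposite,
    (isQuotientCoveringMap_proj ψ).ker_monodromyPerm e]
  have key : ∀ δ : FundamentalGroup (X × ℝ) (x₀, 0),
      FundamentalGroup.mapOfEq (y := fiber ψ x₀)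
        (⟨proj ψ, (isCoveringMap_proj ψ).continuous⟩ : C(X × ℝ, MappingTorus ψ)) rfl δ =
      Path.Homotopic.Quotient.map δ ⟨proj ψ, (isCoveringMap_proj ψ).continuous⟩ := fun δ =>
    (FundamentalGroup.mapOfEq_apply _ _ δ).trans (Path.Homotopic.Quotient.cast_rfl_rfl _)
  have hincl : ∀ ε : FundamentalGroup X x₀, Path.Homotopic.Quotient.map ε cylinderInclusion =
      Path.Homotopic.prod ε (Path.Homotopic.Quotient.refl 0) := by
    intro ε
    induction ε using Path.Homotopic.Quotient.ind with | mk ε => rfl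
  constructor
  · rintro ⟨δ, rfl⟩
    refine ⟨Path.Homotopic.projLeft δ, (map_fiber _).trans (Eq.trans ?_ (key δ).symm)⟩
    have h2 : Path.Homotopic.projRight δ = Path.Homotopic.Quotient.refl 0 :=
      Subsingleton.elim _ _
    have h3 : Path.Homotopic.Quotient.map (Path.Homotopic.projLeft δ) cylinderInclusion = δ := by
      rw [hincl, ← h2]
      exact Path.Homotopic.prod_projLeft_projRight δ
    exact congr_arg (Path.Homotopic.Quotient.map ·
      (⟨proj ψ, (isCoveringMap_proj ψ).continuous⟩ : C(X × ℝ, MappingTorus ψ))) h3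
  · rintro ⟨δ, rfl⟩
    exact ⟨Path.Homotopic.Quotient.map δ cylinderInclusion, (key _).trans (map_fiber δ).symm⟩

theorem _root_.Path.Homotopic.Quotient.mk_trans_cast {Y : Type*} [TopologicalSpace Y] {y y' : Y}
    (h : y = y') {a : Path y y} {b c : Path y y'} {d : Path y' y'}
    (H : Path.Homotopic.Quotient.mk (a.trans b) = .mk (c.trans d)) :
    Path.Homotopic.Quotient.mk (a.trans (b.cast rfl h)) =
      .mk ((c.cast rfl h).trans (d.cast h h)) := by
  subst h
  exact H

/-- In the cylinder, γ at height 0 followed by the vertical segment is homotopic to the segment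
followed by γ at height 1, and the latter projects to ψ ∘ γ in the fibre. Since multiplication
reverses concatenation, this is conjugation by the vertical loop on the left. -/
theorem map_fiber_mapOfEq (γ : FundamentalGroup X x₀) :
    FundamentalGroup.map (fiber ψ) x₀ (FundamentalGroup.mapOfEq (ψ : C(X, X)) h γ) =
      FundamentalGroup.fromPath (.mk (fixedLoop h)) * FundamentalGroup.map (fiber ψ) x₀ γ *
        (FundamentalGroup.fromPath (.mk (fixedLoop h)))⁻¹ := by
  rw [eq_mul_inv_iff_mul_eq]
  induction γ using Path.Homotopic.Quotient.ind with | mk γ =>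
  let q : C(X × ℝ, MappingTorus ψ) := ⟨proj ψ, (isCoveringMap_proj ψ).continuous⟩
  have H0 : Path.Homotopic.Quotient.mk
      ((γ.prod (Path.refl (0 : ℝ))).trans (unitSegment x₀)) =
      .mk ((unitSegment x₀).trans (γ.prod (Path.refl (1 : ℝ)))) := by
    let u : Path (0 : ℝ) 1 := ⟨⟨fun s => s, by fun_prop⟩, by simp, by simp⟩
    have hu : unitSegment x₀ = (Path.refl x₀).prod u := rfl
    rw [hu, Path.trans_prod_eq_prod_trans, Path.trans_prod_eq_prod_trans,
      ← Path.Homotopic.prod_lift, ← Path.Homotopic.prod_lift]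
    congr 1
    · exact (Path.Homotopic.Quotient.trans_refl (.mk γ)).trans
        (Path.Homotopic.Quotient.refl_trans (.mk γ)).symm
    · exact Subsingleton.elim _ _
  have H1 := congr_arg (Path.Homotopic.Quotient.map · q) H0
  simp only [← Path.Homotopic.Quotient.mk_map] at H1
  rw [Path.map_trans, Path.map_trans] at H1
  have hy : fiber ψ x₀ = proj ψ (x₀, 1) := by rw [proj_one, h]
  have H2 := Path.Homotopic.Quotient.mk_trans_cast hy H1
  have H3 : ((γ.prod (Path.refl (1 : ℝ))).map q.continuous).cast hy hy =
      (((γ.map ψ.continuous).cast h.symm h.symm).map (fiber ψ).continuous) := by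
    ext s
    exact proj_one ψ (γ s)
  rw [H3] at H2
  rw [FundamentalGroup.mapOfEq_apply]
  exact H2.symm

end MappingTorus

/-! ### The mapping torus of the braid -/

/-- The automorphism of the fundamental group induced by a homeomorphism fixing the base point. -/
noncomputable def Homeomorph.fundamentalGroupAut {X : Type*} [TopologicalSpace X] (ψ : X ≃ₜ X)
    {x : X} (h : ψ x = x) : MulAut (FundamentalGroup X x) :=
  MonoidHom.toMulEquiv (FundamentalGroup.mapOfEq (ψ : C(X, X)) h)
    (FundamentalGroup.mapOfEq (ψ.symm : C(X, X)) (ψ.symm_apply_eq.2 h.symm))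
    (by
      ext γ
      induction γ using Path.Homotopic.Quotient.ind with | mk γ =>
      rw [MonoidHom.comp_apply, FundamentalGroup.mapOfEq_apply, FundamentalGroup.mapOfEq_apply]
      refine congr_arg Path.Homotopic.Quotient.mk (Path.ext (funext fun t => ?_))
      exact ψ.symm_apply_apply (γ t))
    (by
      ext γ
      induction γ using Path.Homotopic.Quotient.ind with | mk γ =>
      rw [MonoidHom.comp_apply, FundamentalGroup.mapOfEq_apply, FundamentalGroup.mapOfEq_apply]
      refine congr_arg Path.Homotopic.Quotient.mk (Path.ext (funext fun t => ?_))
      exact ψ.apply_symm_apply (γ t))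

/-- Two words with the same exponent sums have the same image in every commutative group. -/
theorem FreeGroup.map_eq_map_of_forall_indicator {κ T M : Type*} [Fintype κ] [DecidableEq κ]
    [CommGroup T] [CommGroup M] {c : M} (hc : ∀ n : ℤ, c ^ n = 1 → n = 0)
    (W : κ → FreeGroup κ →* M) (hW : ∀ i j, W j (of i) = if i = j then c else 1)
    {f g : FreeGroup κ} (hfg : ∀ j, W j f = W j g) (χ : FreeGroup κ →* T) : χ f = χ g := by
  -- Exponent sums: W j is c to the power n j with c of infinite order, so W determines them, and χ
  -- is the product of the powers χ (of j)^(n j).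
  let n : κ → FreeGroup κ →* Multiplicative ℤ := fun j =>
    FreeGroup.lift fun i => if i = j then Multiplicative.ofAdd 1 else 1
  have hn : ∀ i j, n j (of i) = if i = j then Multiplicative.ofAdd 1 else 1 := fun i j =>
    lift_apply_of
  have h1 : ∀ j, W j = (zpowersHom M c).comp (n j) := by
    intro j
    ext i
    rw [MonoidHom.comp_apply, hn, hW]
    split_ifs <;> simp [zpowersHom_apply]
  have h2 : χ = ∏ j, (zpowersHom T (χ (of j))).comp (n j) := by
    ext i
    rw [MonoidHom.finsetProd_apply, Finset.prod_eq_single i]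
    · simp [hn, zpowersHom_apply]
    · intro j _ hj
      simp [hn, hj.symm]
    · simp
  have h3 : ∀ j, n j f = n j g := by
    intro j
    have := hfg j
    rw [h1, MonoidHom.comp_apply, MonoidHom.comp_apply, zpowersHom_apply, zpowersHom_apply,
      ← mul_inv_eq_one, ← zpow_sub] at this
    exact Multiplicative.toAdd.injective (sub_eq_zero.1 (hc _ this))
  rw [h2]
  simp [MonoidHom.finsetProd_apply, h3]

instance : PathConnectedSpace puncturedDisk := by
  have hA := (isSimplyConnected_diskHalf (ε := 1) (by norm_num)).isPathConnected
  have hB := (isSimplyConnected_diskHalf (ε := -1) (by norm_num)).isPathConnected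
  rw [pathConnectedSpace_iff_univ]
  have h := hA.union hB ⟨_, diskCrossing_mem 0⟩
  rwa [Set.eq_univ_of_forall (s := diskHalf 1 ∪ diskHalf (-1)) mem_diskHalf_or] at h

instance {X : Type*} [TopologicalSpace X] [PathConnectedSpace X] (ψ : X ≃ₜ X) :
    PathConnectedSpace (MappingTorus ψ) :=
  Function.Surjective.pathConnectedSpace (f := MappingTorus.proj ψ) Quotient.mk_surjective
    (MappingTorus.isCoveringMap_proj ψ).continuous

/-- The fundamental group of the mapping torus of the braid is an extension of `ℤ` by a free group
of rank three on which `ℤ` permutes the generators cyclically up to commutators. -/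
theorem exists_freeByCyclic_mulEquiv :
    ∃ α : MulAut (FreeGroup (Fin 3)),
      (∀ (T : Type) [CommGroup T] (χ : FreeGroup (Fin 3) →* T) (i : Fin 3),
        χ (α (FreeGroup.of i)) = χ (FreeGroup.of (i + 1))) ∧
      Nonempty (FreeByCyclic α ≃* FundamentalGroup (MappingTorus braidBeta)
        (MappingTorus.fiber braidBeta diskBase)) := by
  obtain ⟨Ψ, hΨ⟩ := exists_freeGroup_mulEquiv
  let α : MulAut (FreeGroup (Fin 3)) :=
    (Ψ.trans (braidBeta.fundamentalGroupAut braidBeta_diskBase)).trans Ψ.symm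
  have hα : ∀ f, Ψ (α f) = FundamentalGroup.mapOfEq
      (braidBeta : C(puncturedDisk, puncturedDisk)) braidBeta_diskBase (Ψ f) := fun f =>
    Ψ.apply_symm_apply _
  refine ⟨α, fun T _ χ i => ?_, ?_⟩
  -- The winding numbers serve as exponent sums, with 2πi as the element of infinite order.
  · refine FreeGroup.map_eq_map_of_forall_indicator
      (c := Multiplicative.ofAdd (2 * Real.pi * Complex.I)) (fun n hn => ?_)
      (fun j => (punctureWinding j).comp Ψ.toMonoidHom) (fun i j => ?_) (fun j => ?_) χ
    · rw [← ofAdd_zsmul, ofAdd_eq_one, zsmul_eq_mul] at hn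
      simpa [Real.pi_ne_zero] using hn
    · change punctureWinding j (Ψ (FreeGroup.of i)) = _
      rw [punctureWinding_of_isCrossingLoop (hΨ i)]
      split_ifs <;> rfl
    · change punctureWinding j (Ψ (α (FreeGroup.of i))) =
        punctureWinding j (Ψ (FreeGroup.of (i + 1)))
      obtain ⟨k, rfl⟩ : ∃ k, j = k + 1 := ⟨j - 1, by simp⟩
      rw [hα, punctureWinding_braidBeta, punctureWinding_of_isCrossingLoop (hΨ i),
        punctureWinding_of_isCrossingLoop (hΨ (i + 1))]
      simp
  · refine nonempty_semidirectProduct_mulEquiv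
      (i := (FundamentalGroup.map (MappingTorus.fiber braidBeta) diskBase).comp Ψ.toMonoidHom)
      (deg := MappingTorus.degree diskBase) (MappingTorus.map_fiber_injective.comp Ψ.injective)
      (fun f => ?_) (MappingTorus.degree_fixedLoop braidBeta_diskBase) (fun g => ?_)
    · change FundamentalGroup.map _ _ (Ψ (α f)) = _
      rw [hα, MappingTorus.map_fiber_mapOfEq]
      rfl
    · rw [MappingTorus.degree_eq_one_iff, MonoidHom.range_comp]
      rw [show Ψ.toMonoidHom.range = ⊤ from MonoidHom.range_eq_top.2 Ψ.surjective,
        MonoidHom.range_eq_map]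

/-- The fundamental group of the mapping torus of the braid `β = σ₁ σ₂⁻¹`, at any base point, is
residually `p` for `p = 3` and for no other prime `p`. -/
theorem mainTheorem12 (x : MappingTorus braidBeta) (p : ℕ) (hp : p.Prime) :
    IsResiduallyP p (FundamentalGroup (MappingTorus braidBeta) x) ↔ p = 3 := by
  obtain ⟨α, hα, ⟨e⟩⟩ := exists_freeByCyclic_mulEquiv
  have e' := e.trans (FundamentalGroup.fundamentalGroupMulEquivOfPathConnected
    (MappingTorus.fiber braidBeta diskBase) x)
  rw [← isResiduallyP_freeByCyclic_iff (s := 1) (by decide) hα hp]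
  exact ⟨fun h => h.of_mulEquiv e'.symm, fun h => h.of_mulEquiv e'⟩
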